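/- Let $G$ be a finite two-player normal form game with strategy sets $S_1,S_2$, $|S_i|=m_i=2$, let $k\ge 1$ be an integer, $\varepsilon\in(0,1]$ and $\beta\in(0,1)$, and let $\square(S)=\Delta(S_1)\times\Delta(S_2)$. For $p\in\Delta(S_{-i})$ let $\widetilde{BR}_i(p)\in S_i$ be the following random strategy: with probability $1-\varepsilon$ player $i$ draws $k$ independent samples from $p$ and plays a strategy drawn uniformly from the set of her pure best replies to the empirical distribution of the sample; with probability $\varepsilon$ she plays a uniformly drawn strategy of $S_i$. Consider the Markov chain on $\square(S)$ which moves from $(p_1,p_2)$ to $\big(\beta p_1+(1-\beta)1_{s_1},\ \beta p_2+(1-\beta)1_{s_2}\big)$, where $s_1=\widetilde{BR}_1(p_2)$ and $s_2=\widetilde{BR}_2(p_1)$ are drawn independently and $1_s$ is the unit vector of the pure strategy $s$. Suppose that $G$ has exactly one Nash equilibrium (in pure or mixed strategies) and that this equilibrium is completely mixed. Then for every $\varepsilon\in(0,1]$ the mean-value process $\dot x_i=\mathbb E[1_{\widetilde{BR}_i(x_{-i})}]-x_i$, $i=1,2$, has a unique stationary point $x^*\in\square(S)$; for every $\varepsilon\in(0,1]$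 and $\beta\in(1/2,1)$ the chain has a unique invariant probability measure $\mu^*_\varepsilon$ on $\square(S)$; and $$\mu^*_\varepsilon\big(\{x\in\square(S):\|x-x^*\|_\infty\ge\eta\}\big)=O\!\left(\exp\!\left(-\frac{K\eta^2}{1-\beta}\right)\right),\qquad \varepsilon>0,\ \eta>0,$$ that is, there are constants $K>0$ and $C>0$, depending only on $G$ and $k$, such that for all $\varepsilon\in(0,1]$, $\beta\in(1/2,1)$ and $\eta>0$ the left-hand side is at most $C\exp\!\left(-K\eta^2/(1-\beta)\right)$. -/

import Mathlib

open MeasureTheory ProbabilityTheory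
open scoped BigOperators

/-- A finite two-player normal form game with pure strategy sets `S₁ = Fin m₁`, `S₂ = Fin m₂`.
`payoffᵢ s₁ s₂` is the payoff of player `i` at the pure strategy profile `(s₁, s₂)`. -/
structure BimatrixGame (m₁ m₂ : ℕ) where
  payoff₁ : Fin m₁ → Fin m₂ → ℝ
  payoff₂ : Fin m₁ → Fin m₂ → ℝ

/-! ### One player: best replies to samples -/

/-- Expected payoff of the pure strategy `s` against the opponent's mixed strategy `σ`, for a
player with payoffs `A s t` (own strategy first, opponent's strategy second). -/
noncomputable def purePayoff {m n : ℕ} (A : Fin m → Fin n → ℝ) (s : Fin m) (σ : Fin n → ℝ) : ℝ :=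
  ∑ t, σ t * A s t

open Classical in
/-- The set of pure best replies to the mixed strategy `σ` of the opponent. -/
noncomputable def bestReplies {m n : ℕ} (A : Fin m → Fin n → ℝ) (σ : Fin n → ℝ) :
    Finset (Fin m) :=
  Finset.univ.filter fun s => ∀ s', purePayoff A s' σ ≤ purePayoff A s σ

open Classical in
/-- Probability that `s` is played when a best reply to `σ` is drawn uniformly from the set of all
pure best replies to `σ`. -/
noncomputable def uniformBestReplyProb {m n : ℕ} (A : Fin m → Fin n → ℝ) (σ : Fin n → ℝ)
    (s : Fin m) : ℝ :=
  if s ∈ bestReplies A σ then ((bestReplies A σ).card : ℝ)⁻¹ else 0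

/-- Probability that `s` is the (uniformly drawn) best reply to the empirical distribution
`D = N / k` of `k` independent samples from `p`; the vector of counts `N` is multinomial with
parameters `k` and `p`. -/
noncomputable def sampledBestReplyProb {m n : ℕ} (A : Fin m → Fin n → ℝ) (k : ℕ)
    (p : Fin n → ℝ) (s : Fin m) : ℝ :=
  ∑ N ∈ Finset.piAntidiag (Finset.univ : Finset (Fin n)) k,
    ((Nat.multinomial Finset.univ N : ℝ) * ∏ t, p t ^ N t) *
      uniformBestReplyProb A (fun t => (N t : ℝ) / k) s

/-- Probability that the noisy sampled best reply to `p` equals `s`: with probability `1 - ε` the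
player best replies to her sample, with probability `ε` she plays a uniformly random strategy. -/
noncomputable def replyProb {m n : ℕ} (A : Fin m → Fin n → ℝ) (k : ℕ) (ε : unitInterval)
    (p : Fin n → ℝ) (s : Fin m) : ℝ :=
  (1 - (ε : ℝ)) * sampledBestReplyProb A k p s + (ε : ℝ) / m

/-! ### The state space and the learning process -/

/-- The space `Δ(S₁) × Δ(S₂)` of mixed strategy profiles. Its `dist` is the one induced by the sup
norm on `ℝ^m₁ × ℝ^m₂`. -/
abbrev MixedProfile (m₁ m₂ : ℕ) : Type :=
  stdSimplex ℝ (Fin m₁) × stdSimplex ℝ (Fin m₂)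

/-- The updated weights `β p + (1 - β) 1_s` after the play of the pure strategy `s`. -/
noncomputable def updateState {m : ℕ} (β : unitInterval) (p : stdSimplex ℝ (Fin m)) (s : Fin m) :
    stdSimplex ℝ (Fin m) :=
  ⟨(β : ℝ) • (p : Fin m → ℝ) + (1 - (β : ℝ)) • Pi.single s (1 : ℝ),
    (convex_stdSimplex ℝ (Fin m)) p.2 (single_mem_stdSimplex ℝ s) β.2.1
      (sub_nonneg.mpr β.2.2) (by ring)⟩

theorem continuous_updateState {m : ℕ} (β : unitInterval) (s : Fin m) :
    Continuous fun p : stdSimplex ℝ (Fin m) => updateState β p s := by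
  unfold updateState
  exact Continuous.subtype_mk (by fun_prop) _

theorem continuous_replyProb {m n : ℕ} (A : Fin m → Fin n → ℝ) (k : ℕ) (ε : unitInterval)
    (s : Fin m) : Continuous fun p : Fin n → ℝ => replyProb A k ε p s := by
  unfold replyProb sampledBestReplyProb
  fun_prop

namespace BimatrixGame

variable {m₁ m₂ : ℕ} (G : BimatrixGame m₁ m₂)

/-- Probability that player `1` plays `s` when the history of player `2` has weights `p`. -/
noncomputable def replyProb₁ (k : ℕ) (ε : unitInterval) (p : Fin m₂ → ℝ) (s : Fin m₁) : ℝ :=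
  replyProb G.payoff₁ k ε p s

/-- Probability that player `2` plays `s` when the history of player `1` has weights `p`. -/
noncomputable def replyProb₂ (k : ℕ) (ε : unitInterval) (p : Fin m₁ → ℝ) (s : Fin m₂) : ℝ :=
  replyProb (fun s₂ s₁ => G.payoff₂ s₁ s₂) k ε p s

/-- The transition law of the learning process from the state `x`: the two players draw their
noisy sampled best replies `s₁`, `s₂` independently, and the state moves to
`(β x₁ + (1 - β) 1_{s₁}, β x₂ + (1 - β) 1_{s₂})`. -/
noncomputable def transitionLaw (k : ℕ) (ε β : unitInterval) (x : MixedProfile m₁ m₂) :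
    Measure (MixedProfile m₁ m₂) :=
  ∑ s₁, ∑ s₂, ENNReal.ofReal (G.replyProb₁ k ε x.2 s₁ * G.replyProb₂ k ε x.1 s₂) •
    Measure.dirac (updateState β x.1 s₁, updateState β x.2 s₂)

theorem measurable_transitionLaw (k : ℕ) (ε β : unitInterval) :
    Measurable (G.transitionLaw k ε β) := by
  refine Measure.measurable_of_measurable_coe _ fun B hB => ?_
  simp only [transitionLaw, Measure.coe_finsetSum, Finset.sum_apply, Measure.smul_apply,
    smul_eq_mul]
  refine Finset.measurable_sum _ fun s₁ _ => Finset.measurable_sum _ fun s₂ _ => ?_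
  refine Measurable.mul ?_ ?_
  · refine Measurable.ennreal_ofReal (Measurable.mul ?_ ?_)
    · exact (continuous_replyProb _ k ε s₁).measurable.comp
        (measurable_subtype_coe.comp measurable_snd)
    · exact (continuous_replyProb _ k ε s₂).measurable.comp
        (measurable_subtype_coe.comp measurable_fst)
  · refine (Measure.measurable_coe hB).comp (Measure.measurable_dirac.comp ?_)
    exact ((continuous_updateState β s₁).measurable.comp measurable_fst).prodMk
      ((continuous_updateState β s₂).measurable.comp measurable_snd)

/-- The Markov kernel of the learning process with sample size `k`, error parameter `ε` and recency
parameter `β`. -/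
noncomputable def transitionKernel (k : ℕ) (ε β : unitInterval) :
    Kernel (MixedProfile m₁ m₂) (MixedProfile m₁ m₂) :=
  ⟨G.transitionLaw k ε β, G.measurable_transitionLaw k ε β⟩

/-- The vector field `F(x) = E[noisy sampled best replies at x] - x` of the mean-value process
`ẋ = F(x)`. A play `s` is identified with the unit vector `1_s`, so that the expected play is the
vector of the probabilities with which the strategies are played. -/
noncomputable def meanField (k : ℕ) (ε : unitInterval) (x : MixedProfile m₁ m₂) :
    (Fin m₁ → ℝ) × (Fin m₂ → ℝ) :=
  (G.replyProb₁ k ε x.2 - x.1, G.replyProb₂ k ε x.1 - x.2)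

/-- `x` is a stationary point of the mean-value process. -/
def IsStationaryPoint (k : ℕ) (ε : unitInterval) (x : MixedProfile m₁ m₂) : Prop :=
  G.meanField k ε x = 0

/-! ### Nash equilibria -/

/-- Expected payoff of player `1` at a mixed profile. -/
noncomputable def expectedPayoff₁ (x : MixedProfile m₁ m₂) : ℝ :=
  ∑ s₁, ∑ s₂, x.1 s₁ * x.2 s₂ * G.payoff₁ s₁ s₂

/-- Expected payoff of player `2` at a mixed profile. -/
noncomputable def expectedPayoff₂ (x : MixedProfile m₁ m₂) : ℝ :=
  ∑ s₁, ∑ s₂, x.1 s₁ * x.2 s₂ * G.payoff₂ s₁ s₂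

/-- Nash equilibria in mixed (possibly pure) strategies. -/
def IsNash (x : MixedProfile m₁ m₂) : Prop :=
  (∀ y₁, G.expectedPayoff₁ (y₁, x.2) ≤ G.expectedPayoff₁ x) ∧
    ∀ y₂, G.expectedPayoff₂ (x.1, y₂) ≤ G.expectedPayoff₂ x

/-- Every pure strategy of either player has positive probability. -/
def IsCompletelyMixed (x : MixedProfile m₁ m₂) : Prop :=
  (∀ s₁, 0 < x.1 s₁) ∧ ∀ s₂, 0 < x.2 s₂

end BimatrixGame

/-! Uniqueness of a completely mixed equilibrium forces best replies to cycle. In suitable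
coordinates, with `u` the weight of player 1's strategy `0` and `v` the weight of player 2's
strategy `j`, the reply probabilities are `(1 - ε) F(v) + ε/2` and `(1 - ε)(1 - H(u)) + ε/2`. Here
`F` and `H` are Bernstein polynomials with monotone coefficients, so they increase from 0 to 1, are
Lipschitz with some constant `L`, and have slope bounded below away from the endpoints. One player
imitates and the other opposes. This negative feedback makes the stationary point `(u₀, v₀)` unique
and keeps it at least `1/(4L²)` from the boundary, whatever `ε` is.

Let `Ψ` and `Φ` be the convex potentials with derivatives `H - H(u₀)` and `F - F(v₀)`. Along the
mean field the cross terms in the derivative of `Ψ(u) + Φ(v)` cancel, as in a zero-sum game, and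
leave a negative drift. The noise of one step contributes only second-order terms, so `V = exp((Ψ(u)
+ Φ(v)) / (2L(1-β)))` satisfies `E[V(next)] ≤ (1 - (1-β)/2) V + (1-β)/2 · e²`. Hence the invariant
mean of `V` is at most `e²`. Quadratic growth of the potentials, with a constant independent of `ε`,
and Markov's inequality give the tail bound (`exp_potential_pair_step_le`,
`IsPotential.quadratic_le`, `IsEquilibrium.bounded_away`).

Existence and uniqueness of the invariant measure hold because the chain applies `β`-contractions
with Lipschitz probabilities, and the trembles bound the probability of one fixed map from below
(`exists_unique_invariant`). -/

/-! ### Invariant measures of random contractions -/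

/-- A finite iterated function system of uniformly contracting maps that are drawn with
Lipschitz place-dependent probabilities, one of which is bounded away from zero. -/
structure RandomContraction (ι X : Type*) [Fintype ι] [PseudoMetricSpace X] where
  map : ι → X → X
  prob : ι → X → ℝ
  ratio : ℝ
  lip : ℝ
  base : ι
  floor : ℝ
  ratio_nonneg : 0 ≤ ratio
  ratio_lt_one : ratio < 1
  dist_map_le : ∀ i x y, dist (map i x) (map i y) ≤ ratio * dist x y
  prob_nonneg : ∀ i x, 0 ≤ prob i x
  sum_prob : ∀ x, ∑ i, prob i x = 1
  lip_nonneg : 0 ≤ lip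
  abs_prob_sub_le : ∀ i x y, |prob i x - prob i y| ≤ lip * dist x y
  floor_pos : 0 < floor
  floor_le_prob : ∀ x, floor ≤ prob base x

theorem integrable_of_continuous {X : Type*} [MetricSpace X] [CompactSpace X] [MeasurableSpace X]
    [BorelSpace X] {f : X → ℝ} (hf : Continuous f) (μ : Measure X) [IsFiniteMeasure μ] :
    Integrable f μ :=
  (BoundedContinuousFunction.mkOfCompact ⟨f, hf⟩).integrable μ

namespace RandomContraction

section Operator

variable {ι X : Type*} [Fintype ι] [PseudoMetricSpace X] (R : RandomContraction ι X)

/-- The expected value of `f` after one step. -/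
noncomputable def op (f : X → ℝ) (x : X) : ℝ := ∑ i, R.prob i x * f (R.map i x)

theorem floor_le_one (x : X) : R.floor ≤ 1 := by
  refine (R.floor_le_prob x).trans ?_
  rw [← R.sum_prob x]
  exact Finset.single_le_sum (fun i _ => R.prob_nonneg i x) (Finset.mem_univ R.base)

theorem op_mono {f g : X → ℝ} (h : ∀ x, f x ≤ g x) (x : X) : R.op f x ≤ R.op g x :=
  Finset.sum_le_sum fun i _ => mul_le_mul_of_nonneg_left (h _) (R.prob_nonneg i x)

theorem op_const (c : ℝ) (x : X) : R.op (fun _ => c) x = c := by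
  simp [op, ← Finset.sum_mul, R.sum_prob]

theorem op_neg (f : X → ℝ) : R.op (fun x => -f x) = fun x => -R.op f x := by
  funext x; simp [op]

theorem iterate_op_neg (f : X → ℝ) (n : ℕ) (x : X) :
    R.op^[n] (fun x => -f x) x = -R.op^[n] f x := by
  induction n generalizing f with
  | zero => rfl
  | succ n ih => rw [Function.iterate_succ_apply, Function.iterate_succ_apply, op_neg, ih]

theorem le_iterate_op {f : X → ℝ} {m : ℝ} (h : ∀ x, m ≤ f x) (n : ℕ) (x : X) :
    m ≤ R.op^[n] f x := by
  induction n generalizing x with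
  | zero => exact h x
  | succ n ih =>
    rw [Function.iterate_succ_apply', ← R.op_const m x]
    exact R.op_mono ih x

theorem iterate_op_le {f : X → ℝ} {M : ℝ} (h : ∀ x, f x ≤ M) (n : ℕ) (x : X) :
    R.op^[n] f x ≤ M := by
  have := R.le_iterate_op (f := fun x => -f x) (m := -M) (fun x => neg_le_neg (h x)) n x
  rw [iterate_op_neg] at this
  linarith

theorem le_op_of_le {f : X → ℝ} {m : ℝ} (h : ∀ x, m ≤ f x) (x : X) :
    (1 - R.floor) * m + R.floor * f (R.map R.base x) ≤ R.op f x := by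
  have h1 : R.prob R.base x * (f (R.map R.base x) - m) ≤
      ∑ i, R.prob i x * (f (R.map i x) - m) :=
    Finset.single_le_sum (f := fun i => R.prob i x * (f (R.map i x) - m))
      (fun i _ => mul_nonneg (R.prob_nonneg i x) (sub_nonneg.2 (h _))) (Finset.mem_univ R.base)
  have h2 : ∑ i, R.prob i x * (f (R.map i x) - m) = R.op f x - m := by
    simp [op, mul_sub, Finset.sum_sub_distrib, ← Finset.sum_mul, R.sum_prob]
  nlinarith [mul_le_mul_of_nonneg_right (R.floor_le_prob x) (sub_nonneg.2 (h (R.map R.base x)))]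

/-- A run of `n` draws of the base map has probability at least `floor ^ n`. On every other path
only the lower bound `m` is used. -/
theorem le_iterate_op_of_le {f : X → ℝ} {m : ℝ} (h : ∀ x, m ≤ f x) (n : ℕ) (x : X) :
    (1 - R.floor ^ n) * m + R.floor ^ n * f ((R.map R.base)^[n] x) ≤ R.op^[n] f x := by
  induction n generalizing x with
  | zero => simp
  | succ n ih =>
    rw [Function.iterate_succ_apply' R.op, Function.iterate_succ_apply (R.map R.base)]
    have h1 := R.le_op_of_le (R.le_iterate_op h n) x
    have h2 := mul_le_mul_of_nonneg_left (ih (R.map R.base x)) R.floor_pos.le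
    rw [pow_succ]
    linarith

theorem iterate_op_le_of_le {f : X → ℝ} {M : ℝ} (h : ∀ x, f x ≤ M) (n : ℕ) (x : X) :
    R.op^[n] f x ≤ (1 - R.floor ^ n) * M + R.floor ^ n * f ((R.map R.base)^[n] x) := by
  have := R.le_iterate_op_of_le (f := fun x => -f x) (m := -M) (fun x => neg_le_neg (h x)) n x
  rw [iterate_op_neg] at this
  linarith

theorem dist_iterate_map_le (n : ℕ) (x y : X) :
    dist ((R.map R.base)^[n] x) ((R.map R.base)^[n] y) ≤ R.ratio ^ n * dist x y := by
  induction n generalizing x y with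
  | zero => simp
  | succ n ih =>
    rw [Function.iterate_succ_apply, Function.iterate_succ_apply, pow_succ, mul_assoc]
    exact (ih _ _).trans
      (mul_le_mul_of_nonneg_left (R.dist_map_le _ _ _) (pow_nonneg R.ratio_nonneg n))

theorem abs_op_sub_le {f : X → ℝ} {m M Λ : ℝ} (hm : ∀ x, m ≤ f x) (hM : ∀ x, f x ≤ M)
    (hΛ : 0 ≤ Λ) (hf : ∀ x y, |f x - f y| ≤ Λ * dist x y) (x y : X) :
    |R.op f x - R.op f y| ≤ (R.ratio * Λ + Fintype.card ι * (R.lip * (M - m))) * dist x y := by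
  -- Since the probabilities sum to 1, `m` may be subtracted from `f` in the second sum. The cost of
  -- changing the probabilities then depends on the range `M - m` only.
  have hdecomp : R.op f x - R.op f y = ∑ i, R.prob i x * (f (R.map i x) - f (R.map i y)) +
      ∑ i, (R.prob i x - R.prob i y) * (f (R.map i y) - m) := by
    have : ∑ i, (R.prob i x - R.prob i y) * m = 0 := by
      rw [← Finset.sum_mul, Finset.sum_sub_distrib, R.sum_prob, R.sum_prob]; ring
    simp only [op, mul_sub, sub_mul, Finset.sum_sub_distrib] at this ⊢
    linarith
  have h1 : |∑ i, R.prob i x * (f (R.map i x) - f (R.map i y))| ≤ Λ * (R.ratio * dist x y) := by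
    refine (Finset.abs_sum_le_sum_abs _ _).trans ?_
    calc _ ≤ ∑ i, R.prob i x * (Λ * (R.ratio * dist x y)) := by
          refine Finset.sum_le_sum fun i _ => ?_
          rw [abs_mul, abs_of_nonneg (R.prob_nonneg i x)]
          exact mul_le_mul_of_nonneg_left ((hf _ _).trans
            (mul_le_mul_of_nonneg_left (R.dist_map_le i x y) hΛ)) (R.prob_nonneg i x)
      _ = _ := by rw [← Finset.sum_mul, R.sum_prob, one_mul]
  have h2 : |∑ i, (R.prob i x - R.prob i y) * (f (R.map i y) - m)| ≤
      Fintype.card ι * (R.lip * dist x y * (M - m)) := by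
    refine (Finset.abs_sum_le_sum_abs _ _).trans ?_
    calc _ ≤ ∑ _i : ι, R.lip * dist x y * (M - m) := by
          refine Finset.sum_le_sum fun i _ => ?_
          rw [abs_mul, abs_of_nonneg (sub_nonneg.2 (hm (R.map i y)))]
          exact mul_le_mul (R.abs_prob_sub_le i x y) (sub_le_sub_right (hM _) m)
            (sub_nonneg.2 (hm _)) (mul_nonneg R.lip_nonneg dist_nonneg)
      _ = _ := by simp
  rw [hdecomp]
  refine (abs_add_le _ _).trans ((add_le_add h1 h2).trans (le_of_eq ?_))
  ring

/-- The operator preserves the bounds `m` and `M`, so Lipschitz constants evolve by `Λ ↦ ratio * Λ +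
c` with the same `c` at every step. They never exceed the larger of the initial value and the fixed
point `c / (1 - ratio)`. -/
theorem exists_lipschitz_iterate_op {f : X → ℝ} {m M Λ : ℝ} (hm : ∀ x, m ≤ f x)
    (hM : ∀ x, f x ≤ M) (hΛ : 0 ≤ Λ) (hf : ∀ x y, |f x - f y| ≤ Λ * dist x y) :
    ∃ Λ', 0 ≤ Λ' ∧ ∀ n x y, |R.op^[n] f x - R.op^[n] f y| ≤ Λ' * dist x y := by
  have hr : 0 < 1 - R.ratio := sub_pos.2 R.ratio_lt_one
  set c : ℝ := Fintype.card ι * (R.lip * (M - m)) with hc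
  set Λ' := max Λ (c / (1 - R.ratio)) with hΛ'
  have h0 : 0 ≤ Λ' := hΛ.trans (le_max_left _ _)
  have hstep : R.ratio * Λ' + c ≤ Λ' := by
    have : c / (1 - R.ratio) ≤ Λ' := le_max_right _ _
    rw [div_le_iff₀ hr] at this
    linarith
  refine ⟨Λ', h0, fun n => ?_⟩
  induction n with
  | zero =>
    exact fun x y => (hf x y).trans (mul_le_mul_of_nonneg_right (le_max_left _ _) dist_nonneg)
  | succ n ih =>
    intro x y
    rw [Function.iterate_succ_apply']
    exact (R.abs_op_sub_le (R.le_iterate_op hm n) (R.iterate_op_le hM n) h0 ih x y).trans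
      (mul_le_mul_of_nonneg_right hstep dist_nonneg)

theorem continuous_op {f : X → ℝ} (hf : Continuous f) : Continuous (R.op f) := by
  refine continuous_finsetSum _ fun i _ => Continuous.mul ?_ (hf.comp ?_)
  · exact (LipschitzWith.of_dist_le_mul (K := ⟨R.lip, R.lip_nonneg⟩)
      fun x y => R.abs_prob_sub_le i x y).continuous
  · exact (LipschitzWith.of_dist_le_mul (K := ⟨R.ratio, R.ratio_nonneg⟩)
      (R.dist_map_le i)).continuous

theorem continuous_iterate_op {f : X → ℝ} (hf : Continuous f) (n : ℕ) :
    Continuous (R.op^[n] f) := by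
  induction n with
  | zero => exact hf
  | succ n ih => rw [Function.iterate_succ_apply']; exact R.continuous_op ih

end Operator

section Compact

variable {ι X : Type*} [Fintype ι] [MetricSpace X] [CompactSpace X]
  (R : RandomContraction ι X)

/-- A run of `N` base draws brings all starting points close together, and the iterates of `f` are
uniformly Lipschitz, so they are almost constant there. Each block of `N` steps therefore maps an
oscillation bound `w` to `(1 - q) w + q τ/2`, whose fixed point is `τ/2`. -/
theorem exists_iterate_op_mem_Icc [Nonempty X] {f : X → ℝ} {Λ : ℝ} (hΛ : 0 ≤ Λ)
    (hf : ∀ x y, |f x - f y| ≤ Λ * dist x y) {τ : ℝ} (hτ : 0 < τ) :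
    ∃ n₀, ∀ n, n₀ ≤ n → ∃ m, ∀ x, m ≤ R.op^[n] f x ∧ R.op^[n] f x ≤ m + τ := by
  obtain ⟨x₀⟩ := ‹Nonempty X›
  set D := Metric.diam (Set.univ : Set X)
  have hD : ∀ x y : X, dist x y ≤ D := fun x y =>
    Metric.dist_le_diam_of_mem isCompact_univ.isBounded (Set.mem_univ x) (Set.mem_univ y)
  have hD0 : 0 ≤ D := Metric.diam_nonneg
  have hlow : ∀ x, f x₀ - Λ * D ≤ f x := fun x => by
    have := (abs_le.1 (hf x₀ x)).2
    linarith [mul_le_mul_of_nonneg_left (hD x₀ x) hΛ]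
  have hupp : ∀ x, f x ≤ f x₀ + Λ * D := fun x => by
    have := (abs_le.1 (hf x x₀)).2
    linarith [mul_le_mul_of_nonneg_left (hD x x₀) hΛ]
  obtain ⟨Λ', hΛ', hlip⟩ := R.exists_lipschitz_iterate_op hlow hupp hΛ hf
  -- Because `Λ'` serves all iterates, one block length `N` works for every block.
  obtain ⟨N, hN⟩ : ∃ N : ℕ, Λ' * (R.ratio ^ N * D) < τ / 4 := by
    have h : Filter.Tendsto (fun N : ℕ => Λ' * (R.ratio ^ N * D)) Filter.atTop
        (nhds (Λ' * (0 * D))) :=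
      ((tendsto_pow_atTop_nhds_zero_of_lt_one R.ratio_nonneg R.ratio_lt_one).mul_const D).const_mul
        Λ'
    simp only [zero_mul, mul_zero] at h
    exact (h.eventually (gt_mem_nhds (by positivity : (0 : ℝ) < τ / 4))).exists
  set q := R.floor ^ N with hq
  have hq0 : 0 < q := pow_pos R.floor_pos N
  have hq1 : q ≤ 1 := pow_le_one₀ R.floor_pos.le (R.floor_le_one x₀)
  set a₀ := 2 * (Λ * D)
  have hblock : ∀ j : ℕ, ∃ m, ∀ x, m ≤ R.op^[N * j] f x ∧
      R.op^[N * j] f x ≤ m + ((1 - q) ^ j * a₀ + τ / 2) := by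
    intro j
    induction j with
    | zero =>
      refine ⟨f x₀ - Λ * D, fun x => ⟨hlow x, ?_⟩⟩
      simp only [mul_zero, Function.iterate_zero, id_eq, pow_zero, one_mul]
      linarith [hupp x]
    | succ j ih =>
      obtain ⟨m, hm⟩ := ih
      set g := R.op^[N * j] f with hg
      set w := (1 - q) ^ j * a₀ + τ / 2 with hw
      have hgx : R.op^[N * (j + 1)] f = R.op^[N] g := by
        rw [hg, ← Function.iterate_add_apply, mul_add, mul_one, add_comm]
      set c := g ((R.map R.base)^[N] x₀)
      have hclose : ∀ x, |g ((R.map R.base)^[N] x) - c| ≤ τ / 4 := fun x =>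
        ((hlip _ _ _).trans (mul_le_mul_of_nonneg_left ((R.dist_iterate_map_le N x x₀).trans
          (mul_le_mul_of_nonneg_left (hD x x₀) (pow_nonneg R.ratio_nonneg N))) hΛ')).trans hN.le
      refine ⟨(1 - q) * m + q * (c - τ / 4), fun x => ?_⟩
      rw [hgx]
      obtain ⟨h1, h2⟩ := abs_le.1 (hclose x)
      have h3 := R.le_iterate_op_of_le (fun x => (hm x).1) N x
      have h4 := R.iterate_op_le_of_le (fun x => (hm x).2) N x
      have h5 : q * (c - τ / 4) ≤ q * g ((R.map R.base)^[N] x) :=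
        mul_le_mul_of_nonneg_left (by linarith) hq0.le
      have h6 : q * g ((R.map R.base)^[N] x) ≤ q * (c + τ / 4) :=
        mul_le_mul_of_nonneg_left (by linarith) hq0.le
      refine ⟨by linarith, ?_⟩
      have h7 : (1 - q) * w = (1 - q) ^ (j + 1) * a₀ + (1 - q) * (τ / 2) := by
        rw [hw, pow_succ]; ring
      nlinarith
  obtain ⟨j, hj⟩ : ∃ j : ℕ, (1 - q) ^ j * a₀ < τ / 2 := by
    have h : Filter.Tendsto (fun j : ℕ => (1 - q) ^ j * a₀) Filter.atTop (nhds (0 * a₀)) :=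
      (tendsto_pow_atTop_nhds_zero_of_lt_one (by linarith) (by linarith)).mul_const a₀
    rw [zero_mul] at h
    exact (h.eventually (gt_mem_nhds (by positivity : (0 : ℝ) < τ / 2))).exists
  obtain ⟨m, hm⟩ := hblock j
  refine ⟨N * j, fun n hn => ⟨m, fun x => ?_⟩⟩
  obtain ⟨d, rfl⟩ := Nat.exists_eq_add_of_le hn
  rw [add_comm, Function.iterate_add_apply]
  exact ⟨R.le_iterate_op (fun y => (hm y).1) d x,
    R.iterate_op_le (fun y => (hm y).2.trans (by linarith)) d x⟩

variable [MeasurableSpace X] [BorelSpace X]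

/-- Both integrals lie in one short interval that contains the range of the iterate. -/
theorem tendsto_integral_iterate_op_sub [Nonempty X] {f : X → ℝ} {Λ : ℝ} (hΛ : 0 ≤ Λ)
    (hf : ∀ x y, |f x - f y| ≤ Λ * dist x y) (μ ν : ProbabilityMeasure X) :
    Filter.Tendsto (fun n => ∫ x, R.op^[n] f x ∂μ - ∫ x, R.op^[n] f x ∂ν) Filter.atTop
      (nhds 0) := by
  have hcont : Continuous f := (LipschitzWith.of_dist_le_mul (K := ⟨Λ, hΛ⟩) hf).continuous
  rw [Metric.tendsto_atTop]
  intro τ hτ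
  obtain ⟨n₀, hn₀⟩ := R.exists_iterate_op_mem_Icc hΛ hf (half_pos hτ)
  refine ⟨n₀, fun n hn => ?_⟩
  obtain ⟨m, hm⟩ := hn₀ n hn
  have key : ∀ ρ : ProbabilityMeasure X,
      m ≤ ∫ x, R.op^[n] f x ∂ρ ∧ ∫ x, R.op^[n] f x ∂ρ ≤ m + τ / 2 := by
    intro ρ
    have hi := integrable_of_continuous (R.continuous_iterate_op hcont n) (ρ : Measure X)
    constructor
    · simpa using integral_mono (μ := (ρ : Measure X)) (integrable_const m) hi fun x => (hm x).1
    · simpa using integral_mono (μ := (ρ : Measure X)) hi (integrable_const (m + τ / 2))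
        fun x => (hm x).2
  rw [Real.dist_eq, sub_zero]
  exact abs_sub_lt_iff.2 ⟨by linarith [(key μ).2, (key ν).1], by linarith [(key ν).2, (key μ).1]⟩

variable (κ : Kernel X X) [IsMarkovKernel κ]

theorem integral_bind_eq {f : X → ℝ} (hf : Continuous f)
    (hκ : ∀ x, κ x = ∑ i, ENNReal.ofReal (R.prob i x) • Measure.dirac (R.map i x))
    (μ : Measure X) [IsProbabilityMeasure μ] :
    ∫ x, f x ∂(μ.bind κ) = ∫ x, R.op f x ∂μ := by
  have hop : ∀ x, ∫ y, f y ∂(κ x) = R.op f x := by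
    intro x
    rw [hκ x, integral_finsetSum_measure]
    · refine Finset.sum_congr rfl fun i _ => ?_
      rw [integral_smul_measure, integral_dirac, ENNReal.toReal_ofReal (R.prob_nonneg i x),
        smul_eq_mul]
    · exact fun i _ => (integrable_dirac (by simp)).smul_measure ENNReal.ofReal_ne_top
  have h := Kernel.integral_comp (η := κ) (κ := Kernel.const Unit μ) (a := ()) (f := f)
    (integrable_of_continuous hf _)
  rw [Kernel.comp_const, Kernel.const_apply, Kernel.const_apply] at h
  rw [h]
  exact integral_congr_ae (Filter.Eventually.of_forall hop)

/-- The chain forgets its initial law when tested on Lipschitz functions, which determine a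
probability measure. This gives uniqueness. Existence comes from a limit point of an orbit in the
compact space of probability measures. -/
theorem exists_unique_invariant [Nonempty X]
    (hκ : ∀ x, κ x = ∑ i, ENNReal.ofReal (R.prob i x) • Measure.dirac (R.map i x)) :
    ∃ μ : ProbabilityMeasure X, κ.Invariant (μ : Measure X) ∧
      ∀ ν : ProbabilityMeasure X, κ.Invariant (ν : Measure X) → ν = μ := by
  have hext : ∀ μ ν : ProbabilityMeasure X,
      (∀ (f : X → ℝ) (Λ : ℝ), 0 ≤ Λ → (∀ x y, |f x - f y| ≤ Λ * dist x y) →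
        ∫ x, f x ∂μ = ∫ x, f x ∂ν) → μ = ν := by
    intro μ ν h
    have : Filter.Tendsto (fun _ : ℕ => μ) Filter.atTop (nhds ν) := by
      rw [tendsto_iff_forall_lipschitz_integral_tendsto]
      rintro f - ⟨L, hL⟩
      rw [h f L L.2 fun x y => hL.dist_le_mul x y]
      exact tendsto_const_nhds
    exact tendsto_nhds_unique tendsto_const_nhds this
  have hlipcont : ∀ (f : X → ℝ) (Λ : ℝ), 0 ≤ Λ → (∀ x y, |f x - f y| ≤ Λ * dist x y) →
      Continuous f := fun f Λ hΛ hf =>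
    (LipschitzWith.of_dist_le_mul (K := ⟨Λ, hΛ⟩) hf).continuous
  let step : ProbabilityMeasure X → ProbabilityMeasure X := fun μ => 
    ⟨(μ : Measure X).bind κ, inferInstance⟩
  have hstep : ∀ (μ : ProbabilityMeasure X) (f : X → ℝ), Continuous f →
      ∫ x, f x ∂(step μ) = ∫ x, R.op f x ∂μ := fun μ f hf =>
    R.integral_bind_eq κ hf hκ (μ : Measure X)
  have hsteps : ∀ (n : ℕ) (μ : ProbabilityMeasure X) (f : X → ℝ), Continuous f →
      ∫ x, f x ∂(step^[n] μ) = ∫ x, R.op^[n] f x ∂μ := by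
    intro n
    induction n with
    | zero => intro μ f _; rfl
    | succ n ih =>
      intro μ f hf
      rw [Function.iterate_succ_apply', hstep _ _ hf, ih _ _ (R.continuous_op hf),
        Function.iterate_succ_apply]
  have hinv : ∀ μ : ProbabilityMeasure X, κ.Invariant (μ : Measure X) ↔ step μ = μ := fun μ => by
    exact (Subtype.coe_inj (a := step μ) (b := μ))
  obtain ⟨x₀⟩ := ‹Nonempty X›
  let μ₀ : ProbabilityMeasure X := ⟨Measure.dirac x₀, inferInstance⟩
  let U : Ultrafilter (ProbabilityMeasure X) :=
    (Filter.hyperfilter ℕ).map fun n => step^[n] μ₀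
  obtain ⟨μ, -, hμ⟩ := isCompact_univ.ultrafilter_le_nhds U (by simp)
  have hlim : Filter.Tendsto (fun n => step^[n] μ₀) (Filter.hyperfilter ℕ) (nhds μ) := hμ
  have hlimf : ∀ f : X → ℝ, Continuous f → Filter.Tendsto (fun n => ∫ x, f x ∂(step^[n] μ₀))
      (Filter.hyperfilter ℕ) (nhds (∫ x, f x ∂μ)) := fun f hf =>
    ProbabilityMeasure.tendsto_iff_forall_integral_tendsto.1 hlim
      (BoundedContinuousFunction.mkOfCompact ⟨f, hf⟩)
  have hμinv : step μ = μ := by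
    refine hext _ _ fun f Λ hΛ hf => ?_
    have hc := hlipcont f Λ hΛ hf
    rw [hstep μ f hc]
    have h1 := hlimf _ (R.continuous_op hc)
    have h2 := hlimf _ hc
    -- The difference compares the chains started from `step μ₀` and from `μ₀`, so it vanishes
    -- without averaging along the orbit.
    have h3 : Filter.Tendsto (fun n => ∫ x, R.op f x ∂(step^[n] μ₀) - ∫ x, f x ∂(step^[n] μ₀))
        (Filter.hyperfilter ℕ) (nhds 0) := by
      refine ((R.tendsto_integral_iterate_op_sub hΛ hf (step μ₀) μ₀).mono_left
        Nat.hyperfilter_le_atTop).congr fun n => ?_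
      rw [hsteps n μ₀ f hc, hsteps n μ₀ _ (R.continuous_op hc), hstep _ _
        (R.continuous_iterate_op hc n), ← Function.iterate_succ_apply,
        ← Function.iterate_succ_apply' R.op]
    exact sub_eq_zero.1 (tendsto_nhds_unique (h1.sub h2) h3)
  refine ⟨μ, (hinv μ).2 hμinv, fun ν hν => hext _ _ fun f Λ hΛ hf => ?_⟩
  have hc := hlipcont f Λ hΛ hf
  have h := R.tendsto_integral_iterate_op_sub hΛ hf ν μ
  refine sub_eq_zero.1 (tendsto_nhds_unique (tendsto_const_nhds.congr fun n => ?_) h)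
  rw [← hsteps n ν f hc, ← hsteps n μ f hc, Function.iterate_fixed ((hinv ν).1 hν),
    Function.iterate_fixed hμinv]

end Compact

end RandomContraction

/-! ### Smooth steps and Bernstein polynomials -/

/-- A Lipschitz function that climbs from `0` to `1` on the unit interval, with slopes bounded
below at every base point away from the ends. -/
structure IsSmoothStep (F : ℝ → ℝ) (L : ℝ) : Prop where
  map_zero : F 0 = 0
  map_one : F 1 = 1
  monotoneOn : MonotoneOn F (Set.Icc 0 1)
  continuous : Continuous F
  sub_le : ∀ x ∈ Set.Icc (0 : ℝ) 1, ∀ y ∈ Set.Icc (0 : ℝ) 1, x ≤ y → F y - F x ≤ L * (y - x)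
  slope_ge : ∀ δ > 0, ∃ c > 0, ∀ z ∈ Set.Icc δ (1 - δ), ∀ y ∈ Set.Icc (0 : ℝ) 1,
    c * (y - z) ^ 2 ≤ (F y - F z) * (y - z)

theorem Polynomial.exists_eval_sub_eq_mul (p : Polynomial ℝ) {a b : ℝ} (hab : a ≤ b) :
    ∃ c ∈ Set.Icc a b, p.eval b - p.eval a = p.derivative.eval c * (b - a) := by
  rcases hab.eq_or_lt with rfl | h
  · exact ⟨a, ⟨le_rfl, le_rfl⟩, by simp⟩
  · obtain ⟨c, hc, hc'⟩ := exists_hasDerivAt_eq_slope (fun x => p.eval x)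
      (fun x => p.derivative.eval x) h p.continuous.continuousOn fun x _ => p.hasDerivAt x
    exact ⟨c, ⟨hc.1.le, hc.2.le⟩, by rw [hc', div_mul_cancel₀ _ (sub_ne_zero.2 h.ne')]⟩

theorem Polynomial.isSmoothStep {p : Polynomial ℝ} {L : ℝ} (h0 : p.eval 0 = 0)
    (h1 : p.eval 1 = 1) (hnonneg : ∀ x ∈ Set.Icc (0 : ℝ) 1, 0 ≤ p.derivative.eval x)
    (hL : ∀ x ∈ Set.Icc (0 : ℝ) 1, p.derivative.eval x ≤ L)
    (hpos : ∀ δ > 0, ∃ c > 0, ∀ x ∈ Set.Icc δ (1 - δ), c ≤ p.derivative.eval x) :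
    IsSmoothStep (fun x => p.eval x) L := by
  have hmono : MonotoneOn (fun x => p.eval x) (Set.Icc 0 1) := by
    intro x hx y hy hxy
    obtain ⟨c, hc, h⟩ := p.exists_eval_sub_eq_mul hxy
    have := mul_nonneg (hnonneg c ⟨hx.1.trans hc.1, hc.2.trans hy.2⟩) (sub_nonneg.2 hxy)
    show p.eval x ≤ p.eval y
    linarith
  refine ⟨h0, h1, hmono, p.continuous, fun x hx y hy hxy => ?_, fun δ hδ => ?_⟩
  · obtain ⟨c, hc, h⟩ := p.exists_eval_sub_eq_mul hxy
    show p.eval y - p.eval x ≤ _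
    rw [h]
    exact mul_le_mul_of_nonneg_right (hL c ⟨hx.1.trans hc.1, hc.2.trans hy.2⟩)
      (sub_nonneg.2 hxy)
  · obtain ⟨c, hc, hcd⟩ := hpos (δ / 2) (half_pos hδ)
    refine ⟨c * (δ / 2), by positivity, fun z hz y hy => ?_⟩
    show _ ≤ (p.eval y - p.eval z) * (y - z)
    obtain ⟨hz1, hz2⟩ := hz
    obtain ⟨hy1, hy2⟩ := hy
    -- The derivative may vanish at 0 and 1. The first fraction `δ / 2` of the way from `z` to `y`
    -- stays in `[δ/2, 1 - δ/2]`, where the slope is at least `c`. Monotonicity covers the rest.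
    set w := z + (y - z) * (δ / 2) with hw
    rcases le_total z y with h | h
    · have hzw : z ≤ w := by nlinarith
      have hwy : w ≤ y := by nlinarith
      have hw1 : w ≤ 1 - δ / 2 := by nlinarith
      obtain ⟨d, hd, he⟩ := p.exists_eval_sub_eq_mul hzw
      have h2 : p.eval w ≤ p.eval y :=
        hmono ⟨by linarith, by linarith⟩ ⟨by linarith, hy2⟩ hwy
      have h3 := hcd d ⟨by linarith [hd.1], by linarith [hd.2]⟩
      have h4 : c * (w - z) ≤ p.eval y - p.eval z := by nlinarith
      have h5 := mul_le_mul_of_nonneg_right h4 (sub_nonneg.2 h)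
      rw [hw] at h5
      linarith
    · have hzw : w ≤ z := by nlinarith
      have hwy : y ≤ w := by nlinarith
      have hw1 : δ / 2 ≤ w := by nlinarith
      obtain ⟨d, hd, he⟩ := p.exists_eval_sub_eq_mul hzw
      have h2 : p.eval y ≤ p.eval w :=
        hmono ⟨by linarith, by linarith⟩ ⟨by linarith, by linarith⟩ hwy
      have h3 := hcd d ⟨by linarith [hd.1], by linarith [hd.2]⟩
      have h4 : c * (z - w) ≤ p.eval z - p.eval y := by nlinarith
      have h5 := mul_le_mul_of_nonneg_right h4 (sub_nonneg.2 h)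
      rw [hw] at h5
      linarith

/-- The Bernstein polynomial of degree `k` with coefficients `h`. -/
noncomputable def bernsteinSum (k : ℕ) (h : ℕ → ℝ) : Polynomial ℝ :=
  ∑ i ∈ Finset.range (k + 1), Polynomial.C (h i) * bernsteinPolynomial ℝ k i

theorem eval_bernsteinSum (k : ℕ) (h : ℕ → ℝ) (x : ℝ) :
    (bernsteinSum k h).eval x =
      ∑ i ∈ Finset.range (k + 1), (k.choose i : ℝ) * x ^ i * (1 - x) ^ (k - i) * h i := by
  rw [bernsteinSum, Polynomial.eval_finsetSum]
  refine Finset.sum_congr rfl fun i _ => ?_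
  simp [bernsteinPolynomial]
  ring

theorem derivative_bernsteinSum (n : ℕ) (h : ℕ → ℝ) :
    (bernsteinSum (n + 1) h).derivative =
      ((n + 1 : ℕ) : Polynomial ℝ) * bernsteinSum n fun i => h (i + 1) - h i := by
  -- Index shift for summation by parts: the term of index `n + 1` vanishes in degree `n`.
  have hlast : ∑ i ∈ Finset.range (n + 1), Polynomial.C (h (i + 1)) *
        bernsteinPolynomial ℝ n (i + 1) + Polynomial.C (h 0) * bernsteinPolynomial ℝ n 0 =
      ∑ i ∈ Finset.range (n + 1), Polynomial.C (h i) * bernsteinPolynomial ℝ n i := by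
    rw [← Finset.sum_range_succ' (fun i => Polynomial.C (h i) * bernsteinPolynomial ℝ n i),
      Finset.sum_range_succ, bernsteinPolynomial.eq_zero_of_lt ℝ (Nat.lt_succ_self n)]
    simp
  simp only [bernsteinSum, Polynomial.C_sub, sub_mul, Finset.sum_sub_distrib]
  rw [← hlast, Finset.sum_range_succ', Polynomial.derivative_add, Polynomial.derivative_sum]
  simp only [Polynomial.derivative_C_mul, bernsteinPolynomial.derivative_succ,
    bernsteinPolynomial.derivative_zero, Nat.add_sub_cancel]
  rw [mul_sub, mul_add, Finset.mul_sum, Finset.mul_sum, ← sub_sub, ← Finset.sum_sub_distrib]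
  rw [sub_eq_add_neg]
  congr 1
  · exact Finset.sum_congr rfl fun i _ => by ring
  · ring

/-- The derivative is `n + 1` times the Bernstein sum of the increments of `h`, which are
nonnegative with total 1. On `[δ, 1 - δ]` every weight is at least `δ ^ n`. For the upper bound the
powers of `x` and `1 - x` are replaced by 1. -/
theorem isSmoothStep_bernsteinSum {n : ℕ} {h : ℕ → ℝ} (h0 : h 0 = 0) (h1 : h (n + 1) = 1)
    (hmono : ∀ i ≤ n, h i ≤ h (i + 1)) :
    IsSmoothStep (fun x => (bernsteinSum (n + 1) h).eval x)
      ((n + 1 : ℕ) * ∑ i ∈ Finset.range (n + 1), (n.choose i : ℝ) * (h (i + 1) - h i)) := by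
  have hΔ : ∀ i ∈ Finset.range (n + 1), 0 ≤ h (i + 1) - h i := fun i hi =>
    sub_nonneg.2 (hmono i (Nat.lt_succ_iff.1 (Finset.mem_range.1 hi)))
  have hder : ∀ x, (bernsteinSum (n + 1) h).derivative.eval x = (n + 1 : ℕ) *
      ∑ i ∈ Finset.range (n + 1),
        (n.choose i : ℝ) * x ^ i * (1 - x) ^ (n - i) * (h (i + 1) - h i) := by
    intro x
    rw [derivative_bernsteinSum, Polynomial.eval_mul, eval_bernsteinSum, Polynomial.eval_natCast]
  refine Polynomial.isSmoothStep ?_ ?_ (fun x hx => ?_) (fun x hx => ?_) fun δ hδ =>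
    ⟨(n + 1 : ℕ) * δ ^ n, by positivity, fun x hx => ?_⟩
  · rw [bernsteinSum, Polynomial.eval_finsetSum]
    simp [bernsteinPolynomial.eval_at_0, h0]
  · rw [bernsteinSum, Polynomial.eval_finsetSum]
    simp [bernsteinPolynomial.eval_at_1, h1]
  · have := sub_nonneg.2 hx.2
    have := hx.1
    rw [hder]
    exact mul_nonneg (Nat.cast_nonneg _) (Finset.sum_nonneg fun i hi =>
      mul_nonneg (by positivity) (hΔ i hi))
  · have hx' := sub_nonneg.2 hx.2
    rw [hder]
    refine mul_le_mul_of_nonneg_left (Finset.sum_le_sum fun i hi =>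
      mul_le_mul_of_nonneg_right ?_ (hΔ i hi)) (Nat.cast_nonneg _)
    rw [mul_assoc]
    exact mul_le_of_le_one_right (Nat.cast_nonneg _) (mul_le_one₀ (pow_le_one₀ hx.1 hx.2)
      (by positivity) (pow_le_one₀ hx' (by linarith [hx.1])))
  · rw [hder]
    refine mul_le_mul_of_nonneg_left ?_ (Nat.cast_nonneg _)
    calc δ ^ n = ∑ i ∈ Finset.range (n + 1), δ ^ n * (h (i + 1) - h i) := by
          rw [← Finset.mul_sum, Finset.sum_range_sub, h0, h1]; ring
      _ ≤ _ := by
          refine Finset.sum_le_sum fun i hi => mul_le_mul_of_nonneg_right ?_ (hΔ i hi)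
          have hi' := Nat.lt_succ_iff.1 (Finset.mem_range.1 hi)
          have hc : (1 : ℝ) ≤ n.choose i := by exact_mod_cast Nat.choose_pos hi'
          have h2 : δ ^ n ≤ x ^ i * (1 - x) ^ (n - i) := by
            calc δ ^ n = δ ^ i * δ ^ (n - i) := by rw [← pow_add, Nat.add_sub_cancel' hi']
              _ ≤ _ := mul_le_mul (pow_le_pow_left₀ hδ.le hx.1 _)
                (pow_le_pow_left₀ hδ.le (by linarith [hx.2]) _) (by positivity)
                (pow_nonneg (hδ.le.trans hx.1) _)
          rw [mul_assoc]
          exact h2.trans (le_mul_of_one_le_left ((pow_nonneg hδ.le n).trans h2) hc)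

/-! ### Sampled best replies with two strategies -/

/-- The mixed strategy with weight `v` on `j` and `1 - v` on the other strategy. -/
def twoPoint (j : Fin 2) (v : ℝ) : Fin 2 → ℝ := fun t => if t = j then v else 1 - v

theorem uniformBestReplyProb_two {n : ℕ} (A : Fin 2 → Fin n → ℝ) (σ : Fin n → ℝ) (s : Fin 2) :
    uniformBestReplyProb A σ s =
      if purePayoff A s σ < purePayoff A (1 - s) σ then 0
      else if purePayoff A s σ = purePayoff A (1 - s) σ then 1 / 2 else 1 := by
  have hmem : ∀ r, r ∈ bestReplies A σ ↔ purePayoff A (1 - r) σ ≤ purePayoff A r σ := by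
    intro r
    fin_cases r <;> simp [bestReplies, Fin.forall_fin_two]
  have hs : (1 : Fin 2) - (1 - s) = s := by fin_cases s <;> rfl
  have hne : s ≠ 1 - s := by fin_cases s <;> decide
  have huniv : ∀ r : Fin 2, r = s ∨ r = 1 - s := by
    intro r; fin_cases r <;> fin_cases s <;> decide
  rw [uniformBestReplyProb]
  rcases lt_trichotomy (purePayoff A s σ) (purePayoff A (1 - s) σ) with h | h | h
  · rw [if_neg (by rw [hmem]; exact not_le.2 h), if_pos h]
  · rw [if_pos ((hmem s).2 h.ge), if_neg h.not_lt, if_pos h]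
    have : bestReplies A σ = {s, 1 - s} := by
      ext r
      rcases huniv r with rfl | rfl
      · simp [hmem, h]
      · simp [hmem, hs, h]
    rw [this, Finset.card_pair hne]
    norm_num
  · rw [if_pos ((hmem s).2 h.le), if_neg h.not_gt, if_neg h.ne']
    have : bestReplies A σ = {s} := by
      ext r
      rcases huniv r with rfl | rfl
      · simp [hmem, h.le]
      · simp [hmem, hs, h, hne.symm]
    rw [this]
    simp

theorem sum_uniformBestReplyProb_two {n : ℕ} (A : Fin 2 → Fin n → ℝ) (σ : Fin n → ℝ) :
    ∑ s, uniformBestReplyProb A σ s = 1 := by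
  rw [Fin.sum_univ_two, uniformBestReplyProb_two, uniformBestReplyProb_two]
  simp only [sub_zero, sub_self]
  rcases lt_trichotomy (purePayoff A 0 σ) (purePayoff A 1 σ) with h | h | h
  · simp [h, h.not_gt, h.ne']
  · norm_num [h]
  · simp [h, h.not_gt, h.ne']

theorem uniformBestReplyProb_nonneg {m n : ℕ} (A : Fin m → Fin n → ℝ) (σ : Fin n → ℝ)
    (s : Fin m) : 0 ≤ uniformBestReplyProb A σ s := by
  rw [uniformBestReplyProb]
  split_ifs <;> positivity

theorem sampledBestReplyProb_nonneg {m n : ℕ} (A : Fin m → Fin n → ℝ) (k : ℕ) {p : Fin n → ℝ}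
    (hp : p ∈ stdSimplex ℝ (Fin n)) (s : Fin m) : 0 ≤ sampledBestReplyProb A k p s :=
  Finset.sum_nonneg fun _ _ => mul_nonneg (mul_nonneg (Nat.cast_nonneg _)
    (Finset.prod_nonneg fun t _ => pow_nonneg (hp.1 t) _)) (uniformBestReplyProb_nonneg _ _ _)

theorem sum_sampledBestReplyProb_two {n : ℕ} (A : Fin 2 → Fin n → ℝ) (k : ℕ) {p : Fin n → ℝ}
    (hp : p ∈ stdSimplex ℝ (Fin n)) : ∑ s, sampledBestReplyProb A k p s = 1 := by
  simp only [sampledBestReplyProb]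
  rw [Finset.sum_comm]
  simp only [← Finset.mul_sum, sum_uniformBestReplyProb_two, mul_one]
  rw [← Finset.sum_pow_eq_sum_piAntidiag, hp.2, one_pow]

theorem replyProb_nonneg {m n : ℕ} (A : Fin m → Fin n → ℝ) (k : ℕ) (ε : unitInterval)
    {p : Fin n → ℝ} (hp : p ∈ stdSimplex ℝ (Fin n)) (s : Fin m) : 0 ≤ replyProb A k ε p s :=
  add_nonneg (mul_nonneg (sub_nonneg.2 ε.2.2) (sampledBestReplyProb_nonneg A k hp s))
    (div_nonneg ε.2.1 (Nat.cast_nonneg m))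

theorem le_replyProb {m n : ℕ} (A : Fin m → Fin n → ℝ) (k : ℕ) (ε : unitInterval)
    {p : Fin n → ℝ} (hp : p ∈ stdSimplex ℝ (Fin n)) (s : Fin m) :
    (ε : ℝ) / m ≤ replyProb A k ε p s :=
  le_add_of_nonneg_left
    (mul_nonneg (sub_nonneg.2 ε.2.2) (sampledBestReplyProb_nonneg A k hp s))

theorem sum_replyProb_two {n : ℕ} (A : Fin 2 → Fin n → ℝ) (k : ℕ) (ε : unitInterval)
    {p : Fin n → ℝ} (hp : p ∈ stdSimplex ℝ (Fin n)) : ∑ s, replyProb A k ε p s = 1 := by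
  simp only [replyProb, Finset.sum_add_distrib, ← Finset.mul_sum,
    sum_sampledBestReplyProb_two A k hp]
  simp
  ring

theorem replyProb_le_one {n : ℕ} (A : Fin 2 → Fin n → ℝ) (k : ℕ) (ε : unitInterval)
    {p : Fin n → ℝ} (hp : p ∈ stdSimplex ℝ (Fin n)) (s : Fin 2) : replyProb A k ε p s ≤ 1 := by
  rw [← sum_replyProb_two A k ε hp]
  exact Finset.single_le_sum (fun s _ => replyProb_nonneg A k ε hp s) (Finset.mem_univ s)

theorem exists_abs_replyProb_sub_le {m n : ℕ} (A : Fin m → Fin n → ℝ) (k : ℕ)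
    (ε : unitInterval) : ∃ L, 0 ≤ L ∧ ∀ (s : Fin m) (p q : stdSimplex ℝ (Fin n)),
      |replyProb A k ε p s - replyProb A k ε q s| ≤ L * dist p q := by
  have h : ∀ s : Fin m, ∃ L : NNReal, LipschitzOnWith L (fun p : Fin n → ℝ => replyProb A k ε p s)
      (stdSimplex ℝ (Fin n)) := by
    intro s
    have hC : ContDiff ℝ 1 fun p : Fin n → ℝ => replyProb A k ε p s := by
      unfold replyProb sampledBestReplyProb
      fun_prop
    exact hC.locallyLipschitz.locallyLipschitzOn.exists_lipschitzOnWith_of_compact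
      (isCompact_stdSimplex (𝕜 := ℝ) (ι := Fin n))
  choose L hL using h
  refine ⟨∑ s, (L s : ℝ), Finset.sum_nonneg fun s _ => (L s).2, fun s p q => ?_⟩
  refine ((hL s).dist_le_mul p p.2 q q.2).trans (mul_le_mul_of_nonneg_right ?_ dist_nonneg)
  exact Finset.single_le_sum (f := fun s => (L s : ℝ)) (fun s _ => (L s).2) (Finset.mem_univ s)

/-- With two opposing strategies a sample is described by the count `i` of `j`, and the multinomial
law becomes binomial. -/
theorem sampledBestReplyProb_twoPoint {m : ℕ} (A : Fin m → Fin 2 → ℝ) (k : ℕ) (j : Fin 2)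
    (v : ℝ) (s : Fin m) :
    sampledBestReplyProb A k (twoPoint j v) s = (bernsteinSum k fun i =>
      uniformBestReplyProb A (fun t => ((if t = j then i else k - i : ℕ) : ℝ) / k) s).eval v := by
  rw [eval_bernsteinSum, sampledBestReplyProb]
  symm
  have hne : j ≠ 1 - j := by fin_cases j <;> decide
  have huniv : (Finset.univ : Finset (Fin 2)) = {j, 1 - j} := by fin_cases j <;> decide
  have hcase : ∀ t : Fin 2, t ≠ j → t = 1 - j := by
    intro t; fin_cases t <;> fin_cases j <;> decide
  have hsum : ∀ N : Fin 2 → ℕ, N ∈ Finset.piAntidiag Finset.univ k ↔ N j + N (1 - j) = k := by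
    intro N
    rw [Finset.mem_piAntidiag, huniv, Finset.sum_pair hne, ← huniv]
    simp
  refine Finset.sum_bij' (fun i _ t => if t = j then i else k - i) (fun N _ => N j) ?_ ?_ ?_ ?_ ?_
  · intro i hi
    rw [hsum, if_pos rfl, if_neg hne.symm]
    have := Finset.mem_range.1 hi
    omega
  · intro N hN
    have := (hsum N).1 hN
    rw [Finset.mem_range]
    omega
  · intro i _
    simp
  · intro N hN
    have := (hsum N).1 hN
    funext t
    by_cases ht : t = j
    · simp [ht]
    · simp only [ht, if_false]
      rw [hcase t ht]
      omega
  · intro i hi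
    have := Finset.mem_range.1 hi
    congr 1
    rw [huniv, Nat.binomial_eq_choose hne, Finset.prod_pair hne]
    simp only [twoPoint, if_true, if_neg hne.symm]
    rw [Nat.add_sub_cancel' (by omega)]
    ring

/-- When `s` is the better reply to `j` and the worse one to the other strategy, the probability
of `s` is a smooth step in the weight of `j`. -/
theorem exists_isSmoothStep_sampledBestReplyProb (A : Fin 2 → Fin 2 → ℝ) {k : ℕ} (hk : 0 < k)
    (s j : Fin 2) (h1 : A (1 - s) j < A s j) (h2 : A s (1 - j) < A (1 - s) (1 - j)) :
    ∃ L, IsSmoothStep (fun v => sampledBestReplyProb A k (twoPoint j v) s) L := by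
  obtain ⟨n, rfl⟩ := Nat.exists_eq_succ_of_ne_zero hk.ne'
  simp only [sampledBestReplyProb_twoPoint]
  -- The payoff advantage of `s` over `1 - s` in a sample with `i` copies of `j`. It increases with
  -- `i` from a negative to a positive value, so the coefficients, which are 0, 1/2 or 1 by its
  -- sign, are monotone.
  set d : ℕ → ℝ := fun i => (i : ℝ) / (n + 1 : ℕ) * (A s j - A (1 - s) j) +
    ((n + 1 - i : ℕ) : ℝ) / (n + 1 : ℕ) * (A s (1 - j) - A (1 - s) (1 - j)) with hd
  have hpay : ∀ i : ℕ, purePayoff A s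
      (fun t => ((if t = j then i else n + 1 - i : ℕ) : ℝ) / (n + 1 : ℕ)) - purePayoff A (1 - s)
      (fun t => ((if t = j then i else n + 1 - i : ℕ) : ℝ) / (n + 1 : ℕ)) = d i := by
    intro i
    have hne : j ≠ 1 - j := by fin_cases j <;> decide
    have huniv : (Finset.univ : Finset (Fin 2)) = {j, 1 - j} := by fin_cases j <;> decide
    simp only [purePayoff, huniv, Finset.sum_pair hne, if_true, if_neg hne.symm, hd]
    ring
  have hh : ∀ i : ℕ, uniformBestReplyProb A
      (fun t => ((if t = j then i else n + 1 - i : ℕ) : ℝ) / (n + 1 : ℕ)) s =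
      if d i < 0 then 0 else if d i = 0 then 1 / 2 else 1 := by
    intro i
    rw [uniformBestReplyProb_two]
    simp only [← hpay, sub_neg, sub_eq_zero]
  have hn : (0 : ℝ) < (n + 1 : ℕ) := by positivity
  refine ⟨_, isSmoothStep_bernsteinSum ?_ ?_ fun i hi => ?_⟩
  · rw [hh, if_pos]
    simp only [hd, Nat.cast_zero, zero_div, zero_mul, zero_add, Nat.sub_zero, div_self hn.ne']
    linarith
  · have : 0 < d (n + 1) := by
      simp only [hd, Nat.sub_self, Nat.cast_zero, zero_div, zero_mul, add_zero, div_self hn.ne']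
      linarith
    rw [hh, if_neg this.not_gt, if_neg this.ne']
  · have hle : d i ≤ d (i + 1) := by
      have e1 : ((n + 1 - i : ℕ) : ℝ) = ((n + 1 - (i + 1) : ℕ) : ℝ) + 1 := by
        have : n + 1 - i = n + 1 - (i + 1) + 1 := by omega
        exact_mod_cast this
      have e2 : d (i + 1) - d i = 1 / (n + 1 : ℕ) *
          ((A s j - A (1 - s) j) - (A s (1 - j) - A (1 - s) (1 - j))) := by
        simp only [hd, e1, Nat.cast_succ i]
        ring
      have : 0 ≤ 1 / ((n + 1 : ℕ) : ℝ) *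
          ((A s j - A (1 - s) j) - (A s (1 - j) - A (1 - s) (1 - j))) :=
        mul_nonneg (by positivity) (by linarith)
      linarith
    simp only [hh]
    rcases lt_trichotomy (d i) 0 with h | h | h
    · rw [if_pos h]
      split_ifs <;> norm_num
    · rw [h, if_neg (lt_irrefl _), if_pos rfl, if_neg (by linarith)]
      split_ifs <;> norm_num
    · rw [if_neg h.not_gt, if_neg h.ne', if_neg (by linarith), if_neg (by linarith)]

/-! ### Convex potentials and exponential drift -/

namespace IsSmoothStep

variable {F H : ℝ → ℝ} {L L' : ℝ}

theorem weaken (hF : IsSmoothStep F L) (h : L ≤ L') : IsSmoothStep F L' :=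
  { hF with
    sub_le := fun x hx y hy hxy => (hF.sub_le x hx y hy hxy).trans
      (mul_le_mul_of_nonneg_right h (sub_nonneg.2 hxy)) }

theorem one_le (hF : IsSmoothStep F L) : 1 ≤ L := by
  have := hF.sub_le 0 (by simp) 1 (by simp) zero_le_one
  rw [hF.map_zero, hF.map_one] at this
  linarith

theorem mem_Icc (hF : IsSmoothStep F L) {x : ℝ} (hx : x ∈ Set.Icc (0 : ℝ) 1) :
    F x ∈ Set.Icc (0 : ℝ) 1 := by
  have h0 := hF.monotoneOn (Set.left_mem_Icc.2 zero_le_one) hx hx.1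
  have h1 := hF.monotoneOn hx (Set.right_mem_Icc.2 zero_le_one) hx.2
  rw [hF.map_zero] at h0
  rw [hF.map_one] at h1
  exact ⟨h0, h1⟩

theorem mul_sub_le (hF : IsSmoothStep F L) {x y : ℝ} (hx : x ∈ Set.Icc (0 : ℝ) 1)
    (hy : y ∈ Set.Icc (0 : ℝ) 1) : (F y - F x) * (y - x) ≤ L * (y - x) ^ 2 := by
  rcases le_total x y with h | h
  · nlinarith [hF.sub_le x hx y hy h]
  · nlinarith [hF.sub_le y hy x hx h]

/-- Cocoercivity of a monotone Lipschitz map. It lets the drift absorb the variance of the noise. -/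
theorem sq_sub_le (hF : IsSmoothStep F L) {x y : ℝ} (hx : x ∈ Set.Icc (0 : ℝ) 1)
    (hy : y ∈ Set.Icc (0 : ℝ) 1) : (F y - F x) ^ 2 ≤ L * ((F y - F x) * (y - x)) := by
  rcases le_total x y with h | h
  · nlinarith [hF.sub_le x hx y hy h, hF.monotoneOn hx hy h]
  · nlinarith [hF.sub_le y hy x hx h, hF.monotoneOn hy hx h]

/-- The integral of a monotone function is convex, with that function as subgradient. -/
theorem exists_primitive (hF : IsSmoothStep F L) : ∃ Q : ℝ → ℝ, Continuous Q ∧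
    ∀ x ∈ Set.Icc (0 : ℝ) 1, ∀ y ∈ Set.Icc (0 : ℝ) 1,
      F x * (y - x) ≤ Q y - Q x ∧ Q y - Q x ≤ F y * (y - x) := by
  have hderiv : ∀ x, HasDerivAt (fun y => ∫ t in (0 : ℝ)..y, F t) (F x) x := fun x =>
    intervalIntegral.integral_hasDerivAt_right (hF.continuous.intervalIntegrable _ _)
      (hF.continuous.stronglyMeasurableAtFilter _ _) hF.continuous.continuousAt
  set Q : ℝ → ℝ := fun y => ∫ t in (0 : ℝ)..y, F t
  have hQ : Continuous Q := continuous_iff_continuousAt.2 fun x => (hderiv x).continuousAt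
  have key : ∀ x ∈ Set.Icc (0 : ℝ) 1, ∀ y ∈ Set.Icc (0 : ℝ) 1, x < y →
      F x * (y - x) ≤ Q y - Q x ∧ Q y - Q x ≤ F y * (y - x) := by
    intro x hx y hy hxy
    obtain ⟨c, hc, hc'⟩ := exists_hasDerivAt_eq_slope Q F hxy hQ.continuousOn fun t _ => hderiv t
    have hcm : c ∈ Set.Icc (0 : ℝ) 1 := ⟨hx.1.trans hc.1.le, hc.2.le.trans hy.2⟩
    have hyx : 0 < y - x := sub_pos.2 hxy
    rw [eq_div_iff hyx.ne'] at hc'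
    rw [← hc']
    exact ⟨mul_le_mul_of_nonneg_right (hF.monotoneOn hx hcm hc.1.le) hyx.le,
      mul_le_mul_of_nonneg_right (hF.monotoneOn hcm hy hc.2.le) hyx.le⟩
  refine ⟨Q, hQ, fun x hx y hy => ?_⟩
  rcases lt_trichotomy x y with h | rfl | h
  · exact key x hx y hy h
  · simp
  · have := key y hy x hx h
    constructor <;> linarith [this.1, this.2]

/-- A convex potential on the unit interval with derivative `F - F z`, vanishing at `z`. -/
structure IsPotential (F : ℝ → ℝ) (z : ℝ) (Φ : ℝ → ℝ) : Prop where
  continuous : Continuous Φ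
  map_base : Φ z = 0
  le_sub : ∀ x ∈ Set.Icc (0 : ℝ) 1, ∀ y ∈ Set.Icc (0 : ℝ) 1, (F x - F z) * (y - x) ≤ Φ y - Φ x
  sub_le : ∀ x ∈ Set.Icc (0 : ℝ) 1, ∀ y ∈ Set.Icc (0 : ℝ) 1, Φ y - Φ x ≤ (F y - F z) * (y - x)

theorem exists_isPotential (hF : IsSmoothStep F L) (z : ℝ) : ∃ Φ, IsPotential F z Φ := by
  obtain ⟨Q, hQ, h⟩ := hF.exists_primitive
  refine ⟨fun y => Q y - Q z - F z * (y - z), by fun_prop, by simp, fun x hx y hy => ?_,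
    fun x hx y hy => ?_⟩
  · have := (h x hx y hy).1
    linarith
  · have := (h x hx y hy).2
    linarith

/-- The slope of `F` is controlled only from the base point `z`. The tangent inequality at the
midpoint of `z` and `y`, where the potential is nonnegative, turns this into quadratic growth at the
cost of a factor 4. -/
theorem IsPotential.quadratic_le {z c : ℝ} {Φ : ℝ → ℝ} (hΦ : IsPotential F z Φ)
    (hz : z ∈ Set.Icc (0 : ℝ) 1)
    (hc : ∀ y ∈ Set.Icc (0 : ℝ) 1, c * (y - z) ^ 2 ≤ (F y - F z) * (y - z)) {y : ℝ}
    (hy : y ∈ Set.Icc (0 : ℝ) 1) : c / 4 * (y - z) ^ 2 ≤ Φ y := by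
  have hm : (y + z) / 2 ∈ Set.Icc (0 : ℝ) 1 :=
    ⟨by linarith [hy.1, hz.1], by linarith [hy.2, hz.2]⟩
  have h1 := hΦ.le_sub _ hm y hy
  have h2 := hΦ.le_sub z hz _ hm
  have h3 := hc _ hm
  rw [hΦ.map_base] at h2
  linarith

theorem IsPotential.le_mul {z : ℝ} {Φ : ℝ → ℝ} (hΦ : IsPotential F z Φ)
    (hz : z ∈ Set.Icc (0 : ℝ) 1) {y : ℝ} (hy : y ∈ Set.Icc (0 : ℝ) 1) :
    Φ y ≤ (F y - F z) * (y - z) := by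
  simpa [hΦ.map_base] using hΦ.sub_le z hz y hy

end IsSmoothStep

/-- A Bernoulli moment generating function bound. -/
theorem bernoulli_exp_le {p r : ℝ} (hp : p ∈ Set.Icc (0 : ℝ) 1) (hr : |r| ≤ 1) :
    p * Real.exp (r * (1 - p)) + (1 - p) * Real.exp (-(r * p)) ≤ Real.exp (r ^ 2) := by
  obtain ⟨hp0, hp1⟩ := hp
  have hquad : ∀ x : ℝ, |x| ≤ 1 → Real.exp x ≤ 1 + x + x ^ 2 := fun x hx => by
    linarith [(abs_le.1 (Real.abs_exp_sub_one_sub_id_le hx)).2]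
  have h1 := hquad (r * (1 - p)) (by
    rw [abs_mul, abs_of_nonneg (sub_nonneg.2 hp1)]
    exact mul_le_one₀ hr (sub_nonneg.2 hp1) (by linarith))
  have h2 := hquad (-(r * p)) (by
    rw [abs_neg, abs_mul, abs_of_nonneg hp0]
    exact mul_le_one₀ hr hp0 hp1)
  have h3 := mul_le_mul_of_nonneg_left h1 hp0
  have h4 := mul_le_mul_of_nonneg_left h2 (sub_nonneg.2 hp1)
  -- The variable is centred, so the first-order terms cancel and only the variance remains.
  have h5 : p * (1 + r * (1 - p) + (r * (1 - p)) ^ 2) +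
      (1 - p) * (1 + -(r * p) + (-(r * p)) ^ 2) = 1 + p * (1 - p) * r ^ 2 := by ring
  have h6 : p * (1 - p) * r ^ 2 ≤ 1 * r ^ 2 :=
    mul_le_mul_of_nonneg_right (by nlinarith) (sq_nonneg r)
  linarith [Real.add_one_le_exp (r ^ 2)]

namespace IsSmoothStep

variable {F H : ℝ → ℝ} {L : ℝ}

/-- A step of size `1 - β` towards `t ∈ {0, 1}` changes the potential by its linear part up to `L (1
- β)²`. After division by `1 - β` the exponent is affine in `t`: its mean gives the drift term, and
its centred part is a scaled Bernoulli variable handled by `bernoulli_exp_le`. -/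
theorem exp_potential_step_le (hF : IsSmoothStep F L) {z : ℝ} {Φ : ℝ → ℝ}
    (hΦ : IsPotential F z Φ) (hz : z ∈ Set.Icc (0 : ℝ) 1) {y p β l : ℝ}
    (hy : y ∈ Set.Icc (0 : ℝ) 1) (hp : p ∈ Set.Icc (0 : ℝ) 1) (hβ0 : 0 ≤ β) (hβ1 : β < 1)
    (hl0 : 0 ≤ l) (hl1 : l ≤ 1) :
    p * Real.exp (l / (1 - β) * Φ (β * y + (1 - β))) +
        (1 - p) * Real.exp (l / (1 - β) * Φ (β * y)) ≤
      Real.exp (l / (1 - β) * Φ y + l * ((F y - F z) * (p - y)) + l * L * (1 - β) +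
        l ^ 2 * (F y - F z) ^ 2) := by
  have hγ : 0 < 1 - β := sub_pos.2 hβ1
  set γ := 1 - β with hγdef
  obtain ⟨hy0, hy1⟩ := hy
  have hL := hF.one_le
  have hmove : ∀ t ∈ Set.Icc (0 : ℝ) 1, l / γ * Φ (β * y + γ * t) ≤
      l / γ * Φ y + l * ((F y - F z) * (t - y)) + l * L * γ := by
    intro t ht
    have hmem : β * y + γ * t ∈ Set.Icc (0 : ℝ) 1 :=
      ⟨add_nonneg (mul_nonneg hβ0 hy0) (mul_nonneg hγ.le ht.1), by nlinarith [ht.2]⟩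
    have h1 := hΦ.sub_le y ⟨hy0, hy1⟩ _ hmem
    have h2 := hF.mul_sub_le ⟨hy0, hy1⟩ hmem
    have hdiff : β * y + γ * t - y = γ * (t - y) := by rw [hγdef]; ring
    rw [hdiff] at h1 h2
    have h3 : (t - y) ^ 2 ≤ 1 := by
      rw [sq_le_one_iff_abs_le_one, abs_le]
      exact ⟨by linarith [ht.1], by linarith [ht.2]⟩
    have h4 : L * (γ * (t - y)) ^ 2 ≤ L * γ ^ 2 := by
      rw [mul_pow]
      exact mul_le_mul_of_nonneg_left (mul_le_of_le_one_right (sq_nonneg γ) h3) (by linarith)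
    have h5 : Φ (β * y + γ * t) ≤ Φ y + γ * ((F y - F z) * (t - y)) + L * γ ^ 2 := by linarith
    calc _ ≤ l / γ * (Φ y + γ * ((F y - F z) * (t - y)) + L * γ ^ 2) :=
          mul_le_mul_of_nonneg_left h5 (div_nonneg hl0 hγ.le)
      _ = _ := by field_simp
  have hA : |l * (F y - F z)| ≤ 1 := by
    rw [abs_mul, abs_of_nonneg hl0]
    refine mul_le_one₀ hl1 (abs_nonneg _) ?_
    have h1 := hF.mem_Icc ⟨hy0, hy1⟩
    have h2 := hF.mem_Icc hz
    rw [abs_le]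
    exact ⟨by linarith [h1.1, h2.2], by linarith [h1.2, h2.1]⟩
  have hB := bernoulli_exp_le hp hA
  set E := l / γ * Φ y + l * ((F y - F z) * (p - y)) + l * L * γ with hE
  have h1 : Real.exp (l / γ * Φ (β * y + γ)) ≤
      Real.exp E * Real.exp (l * (F y - F z) * (1 - p)) := by
    rw [← Real.exp_add, Real.exp_le_exp]
    have := hmove 1 (Set.right_mem_Icc.2 zero_le_one)
    rw [mul_one] at this
    refine this.trans (le_of_eq ?_)
    rw [hE]; ring
  have h0 : Real.exp (l / γ * Φ (β * y)) ≤ Real.exp E * Real.exp (-(l * (F y - F z) * p)) := by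
    rw [← Real.exp_add, Real.exp_le_exp]
    have := hmove 0 (Set.left_mem_Icc.2 zero_le_one)
    rw [mul_zero, add_zero] at this
    refine this.trans (le_of_eq ?_)
    rw [hE]; ring
  calc _ ≤ p * (Real.exp E * Real.exp (l * (F y - F z) * (1 - p))) +
        (1 - p) * (Real.exp E * Real.exp (-(l * (F y - F z) * p))) :=
        add_le_add (mul_le_mul_of_nonneg_left h1 hp.1)
          (mul_le_mul_of_nonneg_left h0 (sub_nonneg.2 hp.2))
    _ = Real.exp E * (p * Real.exp (l * (F y - F z) * (1 - p)) +
        (1 - p) * Real.exp (-(l * (F y - F z) * p))) := by ring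
    _ ≤ Real.exp E * Real.exp ((l * (F y - F z)) ^ 2) :=
        mul_le_mul_of_nonneg_left hB (Real.exp_pos _).le
    _ = _ := by rw [← Real.exp_add, mul_pow]

/-- The probabilities `(u, v)` reproduce themselves when the first player follows `F` and the
second one moves against `H`, both with error rate `e`. -/
def IsEquilibrium (F H : ℝ → ℝ) (e u v : ℝ) : Prop :=
  u = (1 - e) * F v + e / 2 ∧ v = (1 - e) * (1 - H u) + e / 2

theorem noisy_mem_Icc {e a : ℝ} (he : e ∈ Set.Icc (0 : ℝ) 1) (ha : a ∈ Set.Icc (0 : ℝ) 1) :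
    (1 - e) * a + e / 2 ∈ Set.Icc (0 : ℝ) 1 := by
  obtain ⟨he0, he1⟩ := he
  obtain ⟨ha0, ha1⟩ := ha
  constructor <;> nlinarith

theorem exists_isEquilibrium (hF : IsSmoothStep F L) (hH : IsSmoothStep H L) {e : ℝ}
    (he : e ∈ Set.Icc (0 : ℝ) 1) :
    ∃ u ∈ Set.Icc (0 : ℝ) 1, ∃ v ∈ Set.Icc (0 : ℝ) 1, IsEquilibrium F H e u v := by
  set g : ℝ → ℝ := fun u => (1 - e) * (1 - H u) + e / 2 with hg
  have hgm : ∀ u ∈ Set.Icc (0 : ℝ) 1, g u ∈ Set.Icc (0 : ℝ) 1 := fun u hu => by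
    have := hH.mem_Icc hu
    exact noisy_mem_Icc he ⟨by linarith [this.2], by linarith [this.1]⟩
  have hfm : ∀ u ∈ Set.Icc (0 : ℝ) 1, (1 - e) * F (g u) + e / 2 ∈ Set.Icc (0 : ℝ) 1 :=
    fun u hu => noisy_mem_Icc he (hF.mem_Icc (hgm u hu))
  have hcont : Continuous fun u => u - ((1 - e) * F (g u) + e / 2) := by
    have := hF.continuous
    have := hH.continuous
    fun_prop
  obtain ⟨u, hu, h⟩ := intermediate_value_Icc zero_le_one hcont.continuousOn
    (show (0 : ℝ) ∈ _ from ⟨by linarith [(hfm 0 (by simp)).1], by linarith [(hfm 1 (by simp)).2]⟩)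
  exact ⟨u, hu, g u, hgm u hu, sub_eq_zero.1 h, rfl⟩

/-- Negative feedback: a larger `u'` cannot raise `v'`, and a `v'` that is not larger cannot raise
`u'`. -/
theorem IsEquilibrium.fst_le (hF : IsSmoothStep F L) (hH : IsSmoothStep H L) {e u v u' v' : ℝ}
    (he : e ≤ 1) (hu : u ∈ Set.Icc (0 : ℝ) 1) (hv : v ∈ Set.Icc (0 : ℝ) 1)
    (hu' : u' ∈ Set.Icc (0 : ℝ) 1) (hv' : v' ∈ Set.Icc (0 : ℝ) 1)
    (h : IsEquilibrium F H e u v) (h' : IsEquilibrium F H e u' v') : u' ≤ u := by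
  refine le_of_not_gt fun hlt => ?_
  have he' : 0 ≤ 1 - e := sub_nonneg.2 he
  have h1 : v' ≤ v := by
    rw [h.2, h'.2]
    have := mul_le_mul_of_nonneg_left (hH.monotoneOn hu hu' hlt.le) he'
    linarith
  have h2 : u' ≤ u := by
    rw [h.1, h'.1]
    have := mul_le_mul_of_nonneg_left (hF.monotoneOn hv' hv h1) he'
    linarith
  exact absurd hlt h2.not_gt

theorem IsEquilibrium.unique (hF : IsSmoothStep F L) (hH : IsSmoothStep H L) {e u v u' v' : ℝ}
    (he : e ≤ 1) (hu : u ∈ Set.Icc (0 : ℝ) 1) (hv : v ∈ Set.Icc (0 : ℝ) 1)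
    (hu' : u' ∈ Set.Icc (0 : ℝ) 1) (hv' : v' ∈ Set.Icc (0 : ℝ) 1)
    (h : IsEquilibrium F H e u v) (h' : IsEquilibrium F H e u' v') : u = u' ∧ v = v' := by
  have : u = u' := le_antisymm (fst_le hF hH he hu' hv' hu hv h' h)
    (fst_le hF hH he hu hv hu' hv' h h')
  subst this
  exact ⟨rfl, h.2.trans h'.2.symm⟩

/-- A small `x` forces the noise `e / 2` to be small, hence `y ≤ 2 L x`. Going once more round the
loop makes `1 - x` small as well, which is a contradiction: `1 ≤ 2 x + 2 L² x ≤ 4 L² x`. -/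
theorem le_of_feedback_loop {e x y A B : ℝ} (he0 : 0 ≤ e) (hL : 1 ≤ L)
    (hA0 : 0 ≤ A) (hB0 : 0 ≤ B) (hA : A ≤ L * x) (hy : y = (1 - e) * A + e / 2)
    (hB : B ≤ L * y) (hx : 1 - x = (1 - e) * B + e / 2) (hex : e / 2 ≤ x) :
    1 / (4 * L ^ 2) ≤ x := by
  have hx0 : 0 ≤ x := by linarith
  have h1 : y ≤ 2 * L * x := by nlinarith
  have h2 : 1 - x ≤ L * y + x := by nlinarith
  have h3 : L * y ≤ L * (2 * L * x) := mul_le_mul_of_nonneg_left h1 (by linarith)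
  have h4 : x ≤ L ^ 2 * x := le_mul_of_one_le_left hx0 (one_le_pow₀ hL)
  rw [div_le_iff₀ (by positivity)]
  nlinarith

/-- The feedback loop is run from each of the four sides of the unit square. The bound does not
involve `e`, so the final constants are uniform in the error rate. -/
theorem IsEquilibrium.bounded_away (hF : IsSmoothStep F L) (hH : IsSmoothStep H L) {e u v : ℝ}
    (he : e ∈ Set.Icc (0 : ℝ) 1) (hu : u ∈ Set.Icc (0 : ℝ) 1) (hv : v ∈ Set.Icc (0 : ℝ) 1)
    (h : IsEquilibrium F H e u v) :
    u ∈ Set.Icc (1 / (4 * L ^ 2)) (1 - 1 / (4 * L ^ 2)) ∧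
      v ∈ Set.Icc (1 / (4 * L ^ 2)) (1 - 1 / (4 * L ^ 2)) := by
  obtain ⟨he0, he1⟩ := he
  have hL := hF.one_le
  have h0 : (0 : ℝ) ∈ Set.Icc (0 : ℝ) 1 := by simp
  have h1 : (1 : ℝ) ∈ Set.Icc (0 : ℝ) 1 := by simp
  have hFv := hF.mem_Icc hv
  have hHu := hH.mem_Icc hu
  have hF0 := hF.sub_le 0 h0 v hv hv.1
  have hF1 := hF.sub_le v hv 1 h1 hv.2
  have hH0 := hH.sub_le 0 h0 u hu hu.1
  have hH1 := hH.sub_le u hu 1 h1 hu.2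
  rw [hF.map_zero] at hF0
  rw [hF.map_one] at hF1
  rw [hH.map_zero] at hH0
  rw [hH.map_one] at hH1
  have hc : 0 ≤ 1 - e := sub_nonneg.2 he1
  have e1 := mul_nonneg hc hFv.1
  have e2 := mul_nonneg hc hHu.1
  have e3 := mul_nonneg hc (sub_nonneg.2 hFv.2)
  have e4 := mul_nonneg hc (sub_nonneg.2 hHu.2)
  obtain ⟨hu', hv'⟩ := h
  have k1 := le_of_feedback_loop (x := u) (y := 1 - v) he0 hL hHu.1 (sub_nonneg.2 hFv.2)
    (by linarith) (by linarith) (by linarith) (by linarith) (by linarith)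
  have k2 := le_of_feedback_loop (x := 1 - u) (y := v) he0 hL (sub_nonneg.2 hHu.2) hFv.1
    (by linarith) (by linarith) (by linarith) (by linarith) (by linarith)
  have k3 := le_of_feedback_loop (x := v) (y := u) he0 hL hFv.1 hHu.1
    (by linarith) (by linarith) (by linarith) (by linarith) (by linarith)
  have k4 := le_of_feedback_loop (x := 1 - v) (y := 1 - u) he0 hL (sub_nonneg.2 hFv.2)
    (sub_nonneg.2 hHu.2) (by linarith) (by linarith) (by linarith) (by linarith) (by linarith)
  exact ⟨⟨k1, by linarith⟩, ⟨k3, by linarith⟩⟩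

theorem exp_potential_pair_step_le (hF : IsSmoothStep F L) (hH : IsSmoothStep H L)
    {e u₀ v₀ : ℝ} {Φ Ψ : ℝ → ℝ} (he : e ∈ Set.Icc (0 : ℝ) 1) (hu₀ : u₀ ∈ Set.Icc (0 : ℝ) 1)
    (hv₀ : v₀ ∈ Set.Icc (0 : ℝ) 1) (h₀ : IsEquilibrium F H e u₀ v₀)
    (hΦ : IsPotential F v₀ Φ) (hΨ : IsPotential H u₀ Ψ) {u v β : ℝ}
    (hu : u ∈ Set.Icc (0 : ℝ) 1) (hv : v ∈ Set.Icc (0 : ℝ) 1) (hβ0 : 0 ≤ β) (hβ1 : β < 1)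
    {p q : ℝ} (hp : p = (1 - e) * F v + e / 2) (hq : q = (1 - e) * (1 - H u) + e / 2) :
    (p * Real.exp (1 / (2 * L) / (1 - β) * Ψ (β * u + (1 - β))) +
        (1 - p) * Real.exp (1 / (2 * L) / (1 - β) * Ψ (β * u))) *
      (q * Real.exp (1 / (2 * L) / (1 - β) * Φ (β * v + (1 - β))) +
        (1 - q) * Real.exp (1 / (2 * L) / (1 - β) * Φ (β * v))) ≤
      (1 - (1 - β) / 2) * Real.exp (1 / (2 * L) / (1 - β) * (Ψ u + Φ v)) +
        (1 - β) / 2 * Real.exp 2 := by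
  have hL := hF.one_le
  have hγ : 0 < 1 - β := sub_pos.2 hβ1
  have hp' : p ∈ Set.Icc (0 : ℝ) 1 := hp ▸ noisy_mem_Icc he (hF.mem_Icc hv)
  have hq' : q ∈ Set.Icc (0 : ℝ) 1 := by
    have := hH.mem_Icc hu
    exact hq ▸ noisy_mem_Icc he ⟨by linarith [this.2], by linarith [this.1]⟩
  -- With `l * L = 1 / 2` the variance terms use up exactly half of the drift.
  set l := 1 / (2 * L) with hl
  have hlL : l * L = 1 / 2 := by rw [hl]; field_simp
  have hl0 : 0 < l := by positivity
  have hl1 : l ≤ 1 := by nlinarith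
  have h1 := hH.exp_potential_step_le hΨ hu₀ hu hp' hβ0 hβ1 hl0.le hl1
  have h2 := hF.exp_potential_step_le hΦ hv₀ hv hq' hβ0 hβ1 hl0.le hl1
  have hprod := mul_le_mul h1 h2 (add_nonneg (mul_nonneg hq'.1 (Real.exp_pos _).le)
    (mul_nonneg (sub_nonneg.2 hq'.2) (Real.exp_pos _).le)) (Real.exp_pos _).le
  refine hprod.trans ?_
  rw [← Real.exp_add]
  -- The reactions of the two players have opposite signs and the same factor `1 - e`, so the cross
  -- products cancel.
  have hdrift : (H u - H u₀) * (p - u) + (F v - F v₀) * (q - v) =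
      -((H u - H u₀) * (u - u₀)) - (F v - F v₀) * (v - v₀) := by
    have e1 : p = u₀ + (1 - e) * (F v - F v₀) := by
      conv_rhs => rw [h₀.1]
      rw [hp]; ring
    have e2 : q = v₀ - (1 - e) * (H u - H u₀) := by
      conv_rhs => rw [h₀.2]
      rw [hq]; ring
    rw [e1, e2]; ring
  have hsq1 : l ^ 2 * (H u - H u₀) ^ 2 ≤ l / 2 * ((H u - H u₀) * (u - u₀)) := by
    have := mul_le_mul_of_nonneg_left (hH.sq_sub_le hu₀ hu) (sq_nonneg l)
    refine this.trans (le_of_eq ?_)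
    linear_combination (l * ((H u - H u₀) * (u - u₀))) * hlL
  have hsq2 : l ^ 2 * (F v - F v₀) ^ 2 ≤ l / 2 * ((F v - F v₀) * (v - v₀)) := by
    have := mul_le_mul_of_nonneg_left (hF.sq_sub_le hv₀ hv) (sq_nonneg l)
    refine this.trans (le_of_eq ?_)
    linear_combination (l * ((F v - F v₀) * (v - v₀))) * hlL
  have hpot1 := mul_le_mul_of_nonneg_left (hΨ.le_mul hu₀ hu) hl0.le
  have hpot2 := mul_le_mul_of_nonneg_left (hΦ.le_mul hv₀ hv) hl0.le
  have hw : l / (1 - β) * (Ψ u + Φ v) * (1 - β) = l * (Ψ u + Φ v) := by field_simp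
  set w := l / (1 - β) * (Ψ u + Φ v) with hwdef
  have hdrift' := congrArg (fun x => l * x) hdrift
  -- The remaining half of the drift dominates `l / 2 * (Ψ u + Φ v) = (1 - β) / 2 * w`. The two
  -- curvature errors add up to `1 - β = (1 - β) / 2 * 2`, which is the source of `exp 2` after
  -- convexity.
  calc _ ≤ Real.exp ((1 - (1 - β) / 2) * w + (1 - β) / 2 * 2) := by
        rw [Real.exp_le_exp]
        have e3 : l / (1 - β) * Ψ u + l / (1 - β) * Φ v = w := by rw [hwdef]; ring
        have e4 : l * L * (1 - β) = (1 - β) / 2 := by rw [hlL]; ring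
        linarith
    _ ≤ _ := by
        simpa using convexOn_exp.2 (Set.mem_univ w) (Set.mem_univ (2 : ℝ))
          (show 0 ≤ 1 - (1 - β) / 2 by linarith) (show 0 ≤ (1 - β) / 2 by linarith) (by ring)

end IsSmoothStep

/-! ### Coordinates on the two-strategy simplex -/

theorem Fin.ne_one_sub (j : Fin 2) : j ≠ 1 - j := by fin_cases j <;> decide

theorem Fin.one_sub_one_sub (j : Fin 2) : 1 - (1 - j) = j := by fin_cases j <;> rfl

theorem Fin.sum_univ_pair {M : Type*} [AddCommMonoid M] (j : Fin 2) (f : Fin 2 → M) :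
    ∑ s, f s = f j + f (1 - j) := by
  have huniv : (Finset.univ : Finset (Fin 2)) = {j, 1 - j} := by fin_cases j <;> decide
  rw [huniv, Finset.sum_pair (Fin.ne_one_sub j)]

theorem Fin.eq_or_eq_one_sub (j t : Fin 2) : t = j ∨ t = 1 - j := by
  fin_cases t <;> fin_cases j <;> decide

theorem twoPoint_mem_stdSimplex (j : Fin 2) {v : ℝ} (hv : v ∈ Set.Icc (0 : ℝ) 1) :
    twoPoint j v ∈ stdSimplex ℝ (Fin 2) := by
  refine ⟨fun t => ?_, ?_⟩
  · unfold twoPoint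
    split_ifs
    · exact hv.1
    · exact sub_nonneg.2 hv.2
  · rw [Fin.sum_univ_pair j]
    simp [twoPoint, (Fin.ne_one_sub j).symm]

theorem stdSimplex_coe_mem {m : ℕ} (p : stdSimplex ℝ (Fin m)) :
    (p : Fin m → ℝ) ∈ stdSimplex ℝ (Fin m) := p.2

theorem twoPoint_self (j : Fin 2) (v : ℝ) : twoPoint j v j = v := if_pos rfl

theorem stdSimplex_two_apply_one_sub (p : stdSimplex ℝ (Fin 2)) (j : Fin 2) :
    p (1 - j) = 1 - p j := by
  have h : ∑ s, p s = 1 := p.2.2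
  rw [Fin.sum_univ_pair j] at h
  linarith

theorem eq_twoPoint (p : stdSimplex ℝ (Fin 2)) (j : Fin 2) :
    (p : Fin 2 → ℝ) = twoPoint j (p j) := by
  funext t
  rcases Fin.eq_or_eq_one_sub j t with rfl | rfl
  · rw [twoPoint_self]
  · rw [twoPoint, if_neg (Fin.ne_one_sub j).symm, ← stdSimplex_two_apply_one_sub]

theorem stdSimplex_two_apply_mem_Icc (p : stdSimplex ℝ (Fin 2)) (j : Fin 2) :
    p j ∈ Set.Icc (0 : ℝ) 1 := by
  have h := p.2.1 (1 - j)
  exact ⟨p.2.1 j, by rw [← sub_nonneg, ← stdSimplex_two_apply_one_sub]; exact h⟩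

theorem dist_stdSimplex_two (p q : stdSimplex ℝ (Fin 2)) (j : Fin 2) :
    dist p q = |p j - q j| := by
  refine le_antisymm ?_ ?_
  · refine (dist_pi_le_iff (abs_nonneg _)).2 fun t => ?_
    rw [Real.dist_eq]
    rcases Fin.eq_or_eq_one_sub j t with rfl | rfl
    · exact le_rfl
    · refine le_of_eq ?_
      change |p (1 - j) - q (1 - j)| = _
      rw [stdSimplex_two_apply_one_sub, stdSimplex_two_apply_one_sub, abs_sub_comm]
      congr 1
      ring
  · exact dist_le_pi_dist (p : Fin 2 → ℝ) q j

theorem stdSimplex_two_ext {p q : stdSimplex ℝ (Fin 2)} (j : Fin 2) (h : p j = q j) : p = q := by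
  rw [← dist_eq_zero, dist_stdSimplex_two p q j, h, sub_self, abs_zero]

theorem dist_updateState_le {m : ℕ} (β : unitInterval) (p q : stdSimplex ℝ (Fin m)) (s : Fin m) :
    dist (updateState β p s) (updateState β q s) ≤ β * dist p q := by
  rw [Subtype.dist_eq, Subtype.dist_eq]
  simp only [updateState]
  rw [dist_add_right, dist_smul₀, Real.norm_of_nonneg β.2.1]
  exact le_rfl

theorem updateState_apply_self {m : ℕ} (β : unitInterval) (p : stdSimplex ℝ (Fin m))
    (s : Fin m) : updateState β p s s = β * p s + (1 - β) := by
  change ((β : ℝ) • (p : Fin m → ℝ) + (1 - (β : ℝ)) • (Pi.single s 1 : Fin m → ℝ)) s = _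
  simp

theorem updateState_apply_of_ne {m : ℕ} (β : unitInterval) (p : stdSimplex ℝ (Fin m))
    {s t : Fin m} (h : t ≠ s) : updateState β p s t = β * p t := by
  change ((β : ℝ) • (p : Fin m → ℝ) + (1 - (β : ℝ)) • (Pi.single s 1 : Fin m → ℝ)) t = _
  simp [h]

/-! ### Games with a unique, completely mixed equilibrium -/

namespace BimatrixGame

/-- Best replies cycle: player `1` prefers `0` against `j` and `1` against `1 - j`, while player
`2` prefers `1 - j` against `0` and `j` against `1`. -/
structure IsCyclic (G : BimatrixGame 2 2) (j : Fin 2) : Prop where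
  first : G.payoff₁ 1 j < G.payoff₁ 0 j
  first' : G.payoff₁ 0 (1 - j) < G.payoff₁ 1 (1 - j)
  second : G.payoff₂ 0 j < G.payoff₂ 0 (1 - j)
  second' : G.payoff₂ 1 (1 - j) < G.payoff₂ 1 j

theorem isNash_of_signs (G : BimatrixGame 2 2) (x : MixedProfile 2 2)
    (h₁ : ∀ u ∈ Set.Icc (0 : ℝ) 1, (u - x.1 0) * (x.2 0 * (G.payoff₁ 0 0 - G.payoff₁ 1 0) +
      (1 - x.2 0) * (G.payoff₁ 0 1 - G.payoff₁ 1 1)) ≤ 0)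
    (h₂ : ∀ v ∈ Set.Icc (0 : ℝ) 1, (v - x.2 0) * (x.1 0 * (G.payoff₂ 0 0 - G.payoff₂ 0 1) +
      (1 - x.1 0) * (G.payoff₂ 1 0 - G.payoff₂ 1 1)) ≤ 0) : G.IsNash x := by
  have e1 : x.1 1 = 1 - x.1 0 := stdSimplex_two_apply_one_sub x.1 0
  have e2 : x.2 1 = 1 - x.2 0 := stdSimplex_two_apply_one_sub x.2 0
  refine ⟨fun y => ?_, fun y => ?_⟩
  · have e3 : y 1 = 1 - y 0 := stdSimplex_two_apply_one_sub y 0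
    have := h₁ (y 0) (stdSimplex_two_apply_mem_Icc y 0)
    simp only [expectedPayoff₁, Fin.sum_univ_two, e1, e2, e3]
    linarith
  · have e3 : y 1 = 1 - y 0 := stdSimplex_two_apply_one_sub y 0
    have := h₂ (y 0) (stdSimplex_two_apply_mem_Icc y 0)
    simp only [expectedPayoff₂, Fin.sum_univ_two, e1, e2, e3]
    linarith

theorem IsNash.indifferent {G : BimatrixGame 2 2} {x : MixedProfile 2 2} (h : G.IsNash x)
    (hx : IsCompletelyMixed x) :
    x.2 0 * (G.payoff₁ 0 0 - G.payoff₁ 1 0) +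
        (1 - x.2 0) * (G.payoff₁ 0 1 - G.payoff₁ 1 1) = 0 ∧
      x.1 0 * (G.payoff₂ 0 0 - G.payoff₂ 0 1) +
        (1 - x.1 0) * (G.payoff₂ 1 0 - G.payoff₂ 1 1) = 0 := by
  have e1 : x.1 1 = 1 - x.1 0 := stdSimplex_two_apply_one_sub x.1 0
  have e2 : x.2 1 = 1 - x.2 0 := stdSimplex_two_apply_one_sub x.2 0
  have p1 := hx.1 0
  have p2 := hx.2 0
  have q1 := hx.1 1
  have q2 := hx.2 1
  rw [e1] at q1
  rw [e2] at q2
  have key : ∀ a D : ℝ, 0 < a → 0 < 1 - a → (1 - a) * D ≤ 0 → (0 - a) * D ≤ 0 → D = 0 := by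
    intro a D h1 h2 h3 h4
    exact le_antisymm (nonpos_of_mul_nonpos_right h3 h2) (by nlinarith)
  let pt : ∀ v ∈ Set.Icc (0 : ℝ) 1, stdSimplex ℝ (Fin 2) := fun v hv =>
    ⟨twoPoint 0 v, twoPoint_mem_stdSimplex 0 hv⟩
  have hpt0 : ∀ v hv, pt v hv 0 = v := fun v _ => twoPoint_self 0 v
  have hpt1 : ∀ v hv, pt v hv 1 = 1 - v := fun v hv => by
    exact (stdSimplex_two_apply_one_sub (pt v hv) 0).trans (by rw [hpt0 v hv])
  constructor
  · refine key _ _ p1 q1 ?_ ?_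
    · have := h.1 (pt 1 (by simp))
      simp only [expectedPayoff₁, Fin.sum_univ_two, hpt0, hpt1, e1, e2] at this
      linarith
    · have := h.1 (pt 0 (by simp))
      simp only [expectedPayoff₁, Fin.sum_univ_two, hpt0, hpt1, e1, e2] at this
      linarith
  · refine key _ _ p2 q2 ?_ ?_
    · have := h.2 (pt 1 (by simp))
      simp only [expectedPayoff₂, Fin.sum_univ_two, hpt0, hpt1, e1, e2] at this
      linarith
    · have := h.2 (pt 0 (by simp))
      simp only [expectedPayoff₂, Fin.sum_univ_two, hpt0, hpt1, e1, e2] at this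
      linarith

theorem exists_isCyclic (G : BimatrixGame 2 2)
    (hG : ∃ xN : MixedProfile 2 2, IsCompletelyMixed xN ∧ G.IsNash xN ∧
      ∀ y, G.IsNash y → y = xN) : ∃ j, G.IsCyclic j := by
  obtain ⟨x, hmix, hN, huniq⟩ := hG
  obtain ⟨i1, i2⟩ := hN.indifferent hmix
  have hu0 := hmix.1 0
  have hv0 := hmix.2 0
  have hu1 : 0 < 1 - x.1 0 := (hmix.1 1).trans_eq (stdSimplex_two_apply_one_sub x.1 0)
  have hv1 : 0 < 1 - x.2 0 := (hmix.2 1).trans_eq (stdSimplex_two_apply_one_sub x.2 0)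
  have hno : ∀ u ∈ Set.Icc (0 : ℝ) 1, ∀ v ∈ Set.Icc (0 : ℝ) 1,
      (∀ u' ∈ Set.Icc (0 : ℝ) 1, (u' - u) * (v * (G.payoff₁ 0 0 - G.payoff₁ 1 0) +
        (1 - v) * (G.payoff₁ 0 1 - G.payoff₁ 1 1)) ≤ 0) →
      (∀ v' ∈ Set.Icc (0 : ℝ) 1, (v' - v) * (u * (G.payoff₂ 0 0 - G.payoff₂ 0 1) +
        (1 - u) * (G.payoff₂ 1 0 - G.payoff₂ 1 1)) ≤ 0) → u = x.1 0 ∧ v = x.2 0 := by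
    intro u hu v hv h1 h2
    have := huniq (⟨twoPoint 0 u, twoPoint_mem_stdSimplex 0 hu⟩,
      ⟨twoPoint 0 v, twoPoint_mem_stdSimplex 0 hv⟩) (G.isNash_of_signs _ h1 h2)
    rw [← this]
    exact ⟨rfl, rfl⟩
  have hsign : ∀ w a b : ℝ, 0 < w → 0 < 1 - w → w * a + (1 - w) * b = 0 →
      a = 0 ∧ b = 0 ∨ 0 < a ∧ b < 0 ∨ a < 0 ∧ 0 < b := by
    intro w a b h1 h2 h
    rcases lt_trichotomy a 0 with ha | ha | ha
    · exact .inr (.inr ⟨ha, by nlinarith⟩)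
    · subst ha
      exact .inl ⟨rfl, by simpa [h2.ne'] using h⟩
    · exact .inr (.inl ⟨ha, by nlinarith⟩)
  set a := G.payoff₁ 0 0 - G.payoff₁ 1 0 with ha
  set b := G.payoff₁ 0 1 - G.payoff₁ 1 1 with hb
  set c := G.payoff₂ 0 0 - G.payoff₂ 0 1 with hc
  set d := G.payoff₂ 1 0 - G.payoff₂ 1 1 with hd
  rcases hsign _ _ _ hv0 hv1 i1 with ⟨h1, h2⟩ | ⟨h1, h2⟩ | ⟨h1, h2⟩
  · have := (hno (x.1 0) ⟨hu0.le, by linarith⟩ 0 (by simp) (fun u' _ => by simp [h1, h2])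
      (fun v' _ => by simp [i2])).2
    exact absurd this hv0.ne
  all_goals rcases hsign _ _ _ hu0 hu1 i2 with ⟨h3, h4⟩ | ⟨h3, h4⟩ | ⟨h3, h4⟩
  · have := (hno 0 (by simp) (x.2 0) ⟨hv0.le, by linarith⟩ (fun u' _ => by simp [i1])
      (fun v' _ => by simp [h3, h4])).1
    exact absurd this hu0.ne
  · have := (hno 1 (by simp) 1 (by simp) (fun u' h => by nlinarith [h.2])
      (fun v' h => by nlinarith [h.2])).1
    linarith
  · exact ⟨0, by linarith, by simp only [sub_zero]; linarith, by simp only [sub_zero]; linarith,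
      by simp only [sub_zero]; linarith⟩
  · have := (hno 0 (by simp) (x.2 0) ⟨hv0.le, by linarith⟩ (fun u' _ => by simp [i1])
      (fun v' _ => by simp [h3, h4])).1
    exact absurd this hu0.ne
  · exact ⟨1, by linarith, by simp only [sub_self]; linarith, by simp only [sub_self]; linarith,
      by simp only [sub_self]; linarith⟩
  · have := (hno 0 (by simp) 1 (by simp) (fun u' h => by nlinarith [h.1])
      (fun v' h => by nlinarith [h.2])).1
    linarith

/-! ### The learning process as a random contraction -/

section Chain

variable (G : BimatrixGame 2 2) (k : ℕ) (ε β : unitInterval)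

/-- All updates contract by `β`. Trembles alone give the profile `(0, 0)` probability at least `(ε /
2)²`. -/
theorem exists_randomContraction (hε : 0 < (ε : ℝ)) (hβ : (β : ℝ) < 1) :
    ∃ R : RandomContraction (Fin 2 × Fin 2) (MixedProfile 2 2),
      (∀ s x, R.map s x = (updateState β x.1 s.1, updateState β x.2 s.2)) ∧
      ∀ s x, R.prob s x = G.replyProb₁ k ε x.2 s.1 * G.replyProb₂ k ε x.1 s.2 := by
  obtain ⟨L₁, hL₁, h₁⟩ := exists_abs_replyProb_sub_le G.payoff₁ k ε
  obtain ⟨L₂, hL₂, h₂⟩ := exists_abs_replyProb_sub_le (fun s₂ s₁ => G.payoff₂ s₁ s₂) k ε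
  refine ⟨{
    map := fun s x => (updateState β x.1 s.1, updateState β x.2 s.2)
    prob := fun s x => G.replyProb₁ k ε x.2 s.1 * G.replyProb₂ k ε x.1 s.2
    ratio := β
    lip := L₁ + L₂
    base := (0, 0)
    floor := (ε / (2 : ℕ)) * (ε / (2 : ℕ))
    ratio_nonneg := β.2.1
    ratio_lt_one := hβ
    dist_map_le := fun s x y => ?_
    prob_nonneg := fun s x =>
      mul_nonneg (replyProb_nonneg _ k ε (stdSimplex_coe_mem x.2) _) (replyProb_nonneg _ k ε (stdSimplex_coe_mem x.1) _)
    sum_prob := fun x => ?_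
    lip_nonneg := add_nonneg hL₁ hL₂
    abs_prob_sub_le := fun s x y => ?_
    floor_pos := by positivity
    floor_le_prob := fun x => mul_le_mul (le_replyProb _ k ε (stdSimplex_coe_mem x.2) _) (le_replyProb _ k ε (stdSimplex_coe_mem x.1) _)
      (by positivity) (replyProb_nonneg _ k ε (stdSimplex_coe_mem x.2) _) }, fun _ _ => rfl, fun _ _ => rfl⟩
  · rw [Prod.dist_eq, Prod.dist_eq, mul_max_of_nonneg _ _ β.2.1]
    exact max_le_max (dist_updateState_le β _ _ _) (dist_updateState_le β _ _ _)
  · rw [Fintype.sum_prod_type]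
    simp only [← Finset.mul_sum, ← Finset.sum_mul, replyProb₁, replyProb₂]
    rw [sum_replyProb_two _ k ε (stdSimplex_coe_mem x.2), sum_replyProb_two _ k ε (stdSimplex_coe_mem x.1), one_mul]
  · have b₁ := h₁ s.1 x.2 y.2
    have b₂ := h₂ s.2 x.1 y.1
    have n₁ := replyProb_nonneg G.payoff₁ k ε (stdSimplex_coe_mem x.2) s.1
    have n₂ := replyProb_nonneg (fun s₂ s₁ => G.payoff₂ s₁ s₂) k ε (stdSimplex_coe_mem y.1) s.2
    have o₁ := replyProb_le_one G.payoff₁ k ε (stdSimplex_coe_mem x.2) s.1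
    have o₂ := replyProb_le_one (fun s₂ s₁ => G.payoff₂ s₁ s₂) k ε (stdSimplex_coe_mem y.1) s.2
    have d₁ : dist x.1 y.1 ≤ dist x y := le_max_left _ _
    have d₂ : dist x.2 y.2 ≤ dist x y := le_max_right _ _
    simp only [replyProb₁, replyProb₂]
    set a := replyProb G.payoff₁ k ε x.2 s.1
    set a' := replyProb G.payoff₁ k ε y.2 s.1
    set b := replyProb (fun s₂ s₁ => G.payoff₂ s₁ s₂) k ε x.1 s.2
    set b' := replyProb (fun s₂ s₁ => G.payoff₂ s₁ s₂) k ε y.1 s.2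
    have e : a * b - a' * b' = a * (b - b') + (a - a') * b' := by ring
    rw [e]
    refine (abs_add_le _ _).trans ?_
    rw [abs_mul, abs_mul, abs_of_nonneg n₁, abs_of_nonneg n₂]
    have t₁ := mul_le_of_le_one_left (abs_nonneg (b - b')) o₁
    have t₂ := mul_le_of_le_one_right (abs_nonneg (a - a')) o₂
    have t₃ := mul_le_mul_of_nonneg_left d₁ hL₂
    have t₄ := mul_le_mul_of_nonneg_left d₂ hL₁
    linarith

variable {G k ε β}

theorem transitionKernel_apply {R : RandomContraction (Fin 2 × Fin 2) (MixedProfile 2 2)}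
    (hmap : ∀ s x, R.map s x = (updateState β x.1 s.1, updateState β x.2 s.2))
    (hprob : ∀ s x, R.prob s x = G.replyProb₁ k ε x.2 s.1 * G.replyProb₂ k ε x.1 s.2)
    (x : MixedProfile 2 2) : G.transitionKernel k ε β x =
      ∑ s, ENNReal.ofReal (R.prob s x) • Measure.dirac (R.map s x) := by
  simp only [hmap, hprob, Fintype.sum_prod_type]
  rfl

theorem isMarkovKernel_transitionKernel
    {R : RandomContraction (Fin 2 × Fin 2) (MixedProfile 2 2)}
    (hmap : ∀ s x, R.map s x = (updateState β x.1 s.1, updateState β x.2 s.2))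
    (hprob : ∀ s x, R.prob s x = G.replyProb₁ k ε x.2 s.1 * G.replyProb₂ k ε x.1 s.2) :
    IsMarkovKernel (G.transitionKernel k ε β) := by
  refine ⟨fun x => ⟨?_⟩⟩
  rw [transitionKernel_apply hmap hprob]
  simp only [Measure.coe_finsetSum, Finset.sum_apply, Measure.smul_apply, measure_univ,
    smul_eq_mul, mul_one]
  rw [← ENNReal.ofReal_sum_of_nonneg fun i _ => R.prob_nonneg i x, R.sum_prob,
    ENNReal.ofReal_one]

end Chain

/-! ### Reply probabilities in scalar coordinates -/

section Replies

variable (G : BimatrixGame 2 2) (k : ℕ) (ε : unitInterval) (j : Fin 2)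

/-- Probability that the sampled best reply of player `1` is `0`, as a function of the weight
of `j`. -/
noncomputable def sampledReply₁ (v : ℝ) : ℝ :=
  sampledBestReplyProb G.payoff₁ k (twoPoint j v) 0

/-- Probability that the sampled best reply of player `2` is `1 - j`, as a function of the weight
of `0`. -/
noncomputable def sampledReply₂ (u : ℝ) : ℝ :=
  sampledBestReplyProb (fun s₂ s₁ => G.payoff₂ s₁ s₂) k (twoPoint 0 u) (1 - j)

variable {G k j}

theorem IsCyclic.exists_isSmoothStep (h : G.IsCyclic j) (hk : 0 < k) :
    ∃ L, IsSmoothStep (G.sampledReply₁ k j) L ∧ IsSmoothStep (G.sampledReply₂ k j) L := by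
  obtain ⟨L₁, h₁⟩ :=
    exists_isSmoothStep_sampledBestReplyProb G.payoff₁ hk 0 j h.first h.first'
  obtain ⟨L₂, h₂⟩ :=
    exists_isSmoothStep_sampledBestReplyProb (fun s₂ s₁ => G.payoff₂ s₁ s₂) hk (1 - j) 0
      (by rw [Fin.one_sub_one_sub]; exact h.second) (by rw [Fin.one_sub_one_sub]; exact h.second')
  exact ⟨max L₁ L₂, h₁.weaken (le_max_left _ _), h₂.weaken (le_max_right _ _)⟩

variable (G k j)

theorem replyProb₁_zero (x : MixedProfile 2 2) :
    G.replyProb₁ k ε x.2 0 = (1 - ε) * G.sampledReply₁ k j (x.2 j) + ε / 2 := by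
  rw [sampledReply₁, ← eq_twoPoint]
  rfl

theorem replyProb₁_one (x : MixedProfile 2 2) :
    G.replyProb₁ k ε x.2 1 = 1 - G.replyProb₁ k ε x.2 0 := by
  have := sum_replyProb_two G.payoff₁ k ε (stdSimplex_coe_mem x.2)
  rw [Fin.sum_univ_two] at this
  exact eq_sub_of_add_eq' this

theorem replyProb₂_one_sub (x : MixedProfile 2 2) :
    G.replyProb₂ k ε x.1 (1 - j) = 1 - G.replyProb₂ k ε x.1 j := by
  have := sum_replyProb_two (fun s₂ s₁ => G.payoff₂ s₁ s₂) k ε (stdSimplex_coe_mem x.1)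
  rw [Fin.sum_univ_pair j] at this
  exact eq_sub_of_add_eq' this

theorem replyProb₂_self (x : MixedProfile 2 2) :
    G.replyProb₂ k ε x.1 j = (1 - ε) * (1 - G.sampledReply₂ k j (x.1 0)) + ε / 2 := by
  have h1 : G.replyProb₂ k ε x.1 (1 - j) =
      (1 - ε) * G.sampledReply₂ k j (x.1 0) + ε / 2 := by
    rw [sampledReply₂, ← eq_twoPoint]
    rfl
  rw [replyProb₂_one_sub] at h1
  linarith

theorem isStationaryPoint_iff (x : MixedProfile 2 2) :
    G.IsStationaryPoint k ε x ↔ IsSmoothStep.IsEquilibrium (G.sampledReply₁ k j)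
      (G.sampledReply₂ k j) ε (x.1 0) (x.2 j) := by
  rw [IsSmoothStep.IsEquilibrium, ← replyProb₁_zero, ← replyProb₂_self, IsStationaryPoint,
    meanField, Prod.mk_eq_zero, sub_eq_zero, sub_eq_zero]
  refine and_congr ⟨fun h => (congrFun h 0).symm, fun h => ?_⟩
    ⟨fun h => (congrFun h j).symm, fun h => ?_⟩
  · funext t
    rcases Fin.eq_or_eq_one_sub 0 t with rfl | rfl
    · exact h.symm
    · exact (replyProb₁_one G k ε x).trans
        ((congrArg (1 - ·) h.symm).trans (stdSimplex_two_apply_one_sub x.1 0).symm)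
  · funext t
    rcases Fin.eq_or_eq_one_sub j t with rfl | rfl
    · exact h.symm
    · exact (replyProb₂_one_sub G k ε _ x).trans
        ((congrArg (1 - ·) h.symm).trans (stdSimplex_two_apply_one_sub x.2 _).symm)

/-- Given the current state the players draw independently, so the expectation of a product
factorizes. -/
theorem op_mul_eq {β : unitInterval} {R : RandomContraction (Fin 2 × Fin 2) (MixedProfile 2 2)}
    (hmap : ∀ s x, R.map s x = (updateState β x.1 s.1, updateState β x.2 s.2))
    (hprob : ∀ s x, R.prob s x = G.replyProb₁ k ε x.2 s.1 * G.replyProb₂ k ε x.1 s.2)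
    (f g : ℝ → ℝ) (x : MixedProfile 2 2) :
    R.op (fun y => f (y.1 0) * g (y.2 j)) x =
      (G.replyProb₁ k ε x.2 0 * f (β * x.1 0 + (1 - β)) +
        (1 - G.replyProb₁ k ε x.2 0) * f (β * x.1 0)) *
      (G.replyProb₂ k ε x.1 j * g (β * x.2 j + (1 - β)) +
        (1 - G.replyProb₂ k ε x.1 j) * g (β * x.2 j)) := by
  simp only [RandomContraction.op, hmap, hprob, Fintype.sum_prod_type]
  rw [Fin.sum_univ_two, Fin.sum_univ_pair j, Fin.sum_univ_pair j, updateState_apply_self,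
    updateState_apply_self, updateState_apply_of_ne β x.1 (show (0 : Fin 2) ≠ 1 by decide),
    updateState_apply_of_ne β x.2 (Fin.ne_one_sub j), replyProb₁_one, replyProb₂_one_sub]
  ring

end Replies

end BimatrixGame

/-! ### Concentration of the invariant measure -/

theorem theorem3 (G : BimatrixGame 2 2)
    (hG : ∃ xN : MixedProfile 2 2, BimatrixGame.IsCompletelyMixed xN ∧
      G.IsNash xN ∧ ∀ y, G.IsNash y → y = xN)
    (k : ℕ) (hk : 0 < k) :
    ∃ K > (0 : ℝ), ∃ C > (0 : ℝ), ∀ ε : unitInterval, 0 < (ε : ℝ) →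
      ∃ xstar : MixedProfile 2 2,
        (G.IsStationaryPoint k ε xstar ∧ ∀ y, G.IsStationaryPoint k ε y → y = xstar) ∧
        ∀ β : unitInterval, 1 / 2 < (β : ℝ) → (β : ℝ) < 1 →
          ∃ μ : ProbabilityMeasure (MixedProfile 2 2),
            ((G.transitionKernel k ε β).Invariant (μ : Measure (MixedProfile 2 2)) ∧
              ∀ ν : ProbabilityMeasure (MixedProfile 2 2),
                (G.transitionKernel k ε β).Invariant (ν : Measure (MixedProfile 2 2)) → ν = μ) ∧
            ∀ η : ℝ, 0 < η →
              (μ : Measure (MixedProfile 2 2)).real {x | η ≤ dist x xstar} ≤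
                C * Real.exp (-(K * η ^ 2 / (1 - (β : ℝ)))) := by
  obtain ⟨j, hj⟩ := G.exists_isCyclic hG
  obtain ⟨L, hF, hH⟩ := hj.exists_isSmoothStep hk
  have hL := hF.one_le
  -- The slope constants are fixed before `ε`: every stationary point stays `1 / (4 * L ^ 2)` away
  -- from the boundary.
  obtain ⟨cF, hcF, hcF'⟩ := hF.slope_ge (1 / (4 * L ^ 2)) (by positivity)
  obtain ⟨cH, hcH, hcH'⟩ := hH.slope_ge (1 / (4 * L ^ 2)) (by positivity)
  set c := min cF cH with hc
  have hc0 : 0 < c := lt_min hcF hcH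
  -- The rate is the product of `1 / (2 * L)` from the exponent `θ` and `c / 4` from the quadratic
  -- growth; `exp 2` bounds the invariant mean of `V`.
  refine ⟨c / (8 * L), by positivity, Real.exp 2, Real.exp_pos 2, fun ε hε => ?_⟩
  obtain ⟨u, hu, v, hv, heq⟩ := hF.exists_isEquilibrium hH ε.2
  obtain ⟨hu', hv'⟩ := heq.bounded_away hF hH ε.2 hu hv
  let xstar : MixedProfile 2 2 := (⟨twoPoint 0 u, twoPoint_mem_stdSimplex 0 hu⟩,
    ⟨twoPoint j v, twoPoint_mem_stdSimplex j hv⟩)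
  have hx1 : xstar.1 0 = u := twoPoint_self 0 u
  have hx2 : xstar.2 j = v := twoPoint_self j v
  refine ⟨xstar, ⟨(G.isStationaryPoint_iff k ε j xstar).2 (by rwa [hx1, hx2]), fun y hy => ?_⟩,
    fun β _ hβ => ?_⟩
  · have := heq.unique hF hH ε.2.2 hu hv (stdSimplex_two_apply_mem_Icc y.1 0)
      (stdSimplex_two_apply_mem_Icc y.2 j) ((G.isStationaryPoint_iff k ε j y).1 hy)
    exact Prod.ext (stdSimplex_two_ext 0 (by rw [hx1, this.1]))
      (stdSimplex_two_ext j (by rw [hx2, this.2]))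
  obtain ⟨R, hmap, hprob⟩ := G.exists_randomContraction k ε β hε hβ
  have hκ := BimatrixGame.transitionKernel_apply hmap hprob
  have := BimatrixGame.isMarkovKernel_transitionKernel hmap hprob
  have : Nonempty (MixedProfile 2 2) := ⟨xstar⟩
  obtain ⟨μ, hμ, hμuniq⟩ := R.exists_unique_invariant _ hκ
  refine ⟨μ, ⟨hμ, hμuniq⟩, fun η hη => ?_⟩
  obtain ⟨Φ, hΦ⟩ := hF.exists_isPotential v
  obtain ⟨Ψ, hΨ⟩ := hH.exists_isPotential u
  have hγ : 0 < 1 - (β : ℝ) := sub_pos.2 hβ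
  set θ := 1 / (2 * L) / (1 - (β : ℝ)) with hθ
  have hθ0 : 0 < θ := by positivity
  set V : MixedProfile 2 2 → ℝ :=
    fun y => Real.exp (θ * Ψ (y.1 0)) * Real.exp (θ * Φ (y.2 j)) with hV
  have hVcont : Continuous V := by
    have h1 : Continuous fun y : MixedProfile 2 2 => y.1 0 :=
      (continuous_apply 0).comp (continuous_subtype_val.comp continuous_fst)
    have h2 : Continuous fun y : MixedProfile 2 2 => y.2 j :=
      (continuous_apply j).comp (continuous_subtype_val.comp continuous_snd)
    exact ((hΨ.continuous.comp h1).const_mul θ).rexp.mul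
      ((hΦ.continuous.comp h2).const_mul θ).rexp
  have hVint := integrable_of_continuous hVcont (μ : Measure (MixedProfile 2 2))
  have hdrift : ∀ y, R.op V y ≤ (1 - (1 - β) / 2) * V y + (1 - β) / 2 * Real.exp 2 := by
    intro y
    rw [hV, G.op_mul_eq k ε j hmap hprob (fun t => Real.exp (θ * Ψ t))
      (fun t => Real.exp (θ * Φ t))]
    simp only [← Real.exp_add (θ * Ψ (y.1 0)), ← mul_add θ]
    exact hF.exp_potential_pair_step_le hH ε.2 hu hv heq hΦ hΨ
      (stdSimplex_two_apply_mem_Icc y.1 0) (stdSimplex_two_apply_mem_Icc y.2 j) β.2.1 hβ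
      (G.replyProb₁_zero k ε j y) (G.replyProb₂_self k ε j y)
  -- By invariance `R.op V` and `V` have the same integral, so the drift inequality can be solved
  -- for it.
  have hmean : ∫ y, V y ∂(μ : Measure (MixedProfile 2 2)) ≤ Real.exp 2 := by
    have h1 := R.integral_bind_eq _ hVcont hκ (μ : Measure (MixedProfile 2 2))
    rw [hμ.def] at h1
    have h2 := integral_mono (μ := (μ : Measure (MixedProfile 2 2)))
      (integrable_of_continuous (R.continuous_op hVcont) _)
      ((hVint.const_mul (1 - (1 - (β : ℝ)) / 2)).add
        (integrable_const ((1 - (β : ℝ)) / 2 * Real.exp 2))) hdrift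
    simp only [Pi.add_apply] at h2
    rw [integral_add (hVint.const_mul _) (integrable_const _), integral_const_mul] at h2
    simp only [integral_const, probReal_univ, one_smul] at h2
    rw [← h1] at h2
    nlinarith
  have hsub : {x | η ≤ dist x xstar} ⊆
      {x | Real.exp (c / (8 * L) * η ^ 2 / (1 - (β : ℝ))) ≤ V x} := by
    intro y hy
    have hy' : η ≤ max |y.1 0 - u| |y.2 j - v| := by
      have : dist y xstar = max (dist y.1 xstar.1) (dist y.2 xstar.2) := rfl
      rw [dist_stdSimplex_two _ _ 0, dist_stdSimplex_two _ _ j, hx1, hx2] at this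
      exact hy.trans_eq this
    have q1 : cH / 4 * (y.1 0 - u) ^ 2 ≤ Ψ (y.1 0) :=
      hΨ.quadratic_le hu (hcH' u hu') (stdSimplex_two_apply_mem_Icc y.1 0)
    have q2 : cF / 4 * (y.2 j - v) ^ 2 ≤ Φ (y.2 j) :=
      hΦ.quadratic_le hv (hcF' v hv') (stdSimplex_two_apply_mem_Icc y.2 j)
    have m1 : c / 4 * (y.1 0 - u) ^ 2 ≤ cH / 4 * (y.1 0 - u) ^ 2 :=
      mul_le_mul_of_nonneg_right (by linarith [min_le_right cF cH]) (sq_nonneg _)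
    have m2 : c / 4 * (y.2 j - v) ^ 2 ≤ cF / 4 * (y.2 j - v) ^ 2 :=
      mul_le_mul_of_nonneg_right (by linarith [min_le_left cF cH]) (sq_nonneg _)
    have n1 : 0 ≤ c / 4 * (y.1 0 - u) ^ 2 := by positivity
    have n2 : 0 ≤ c / 4 * (y.2 j - v) ^ 2 := by positivity
    have hlow : c / 4 * η ^ 2 ≤ Ψ (y.1 0) + Φ (y.2 j) := by
      rcases le_max_iff.1 hy' with h | h
      · have := pow_le_pow_left₀ hη.le h 2
        rw [sq_abs] at this
        nlinarith
      · have := pow_le_pow_left₀ hη.le h 2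
        rw [sq_abs] at this
        nlinarith
    show _ ≤ Real.exp (θ * Ψ (y.1 0)) * Real.exp (θ * Φ (y.2 j))
    rw [← Real.exp_add, Real.exp_le_exp, ← mul_add]
    refine le_trans (le_of_eq ?_) (mul_le_mul_of_nonneg_left hlow hθ0.le)
    rw [hθ]
    field_simp
    ring
  have hmarkov := mul_meas_ge_le_integral_of_nonneg (μ := (μ : Measure (MixedProfile 2 2)))
    (Filter.Eventually.of_forall fun y => by positivity) hVint
    (Real.exp (c / (8 * L) * η ^ 2 / (1 - (β : ℝ))))
  rw [Real.exp_neg, ← div_eq_mul_inv, le_div_iff₀ (Real.exp_pos _), mul_comm]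
  exact (mul_le_mul_of_nonneg_left (measureReal_mono hsub) (Real.exp_pos _).le).trans
    (hmarkov.trans hmean)
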